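/- Let $X_1,X_2,\dots$ be i.i.d. real random variables with distribution function $F$, and let $\gamma>0$. Suppose that $F\in\mathrm{DoA}(G_\gamma)$, i.e. there are $a_n>0$ and $b_n\in\mathbb R$ with $F^n(a_nx+b_n)\to G_\gamma(x)$ for all $x\in\mathbb R$, where $G_\gamma(x)=\exp(-x^{-1/\gamma})$ for $x>0$ and $G_\gamma(x)=0$ for $x\le 0$. Let $X_{(1,n)}\le\dots\le X_{(n,n)}$ be the order statistics of $X_1,\dots,X_n$, and for $1\le k<n$ let $$\hat\gamma_k=\hat\gamma_{n,k}=\frac1k\sum_{i=1}^k\log\left(\frac{X_{(n-i+1,n)}}{X_{(n-k,n)}}\right)$$ be the Hill estimator (where the ratio is not a positive number, read $\log y$ as $\log|y|$, and use $\log 0=0$ and $y/0=0$). Let $U(x)=\inf\{y\in\mathbb R: F(y)\ge 1-1/x\}$ for $x>1$. Then there are random variables $G_{n,k}$ and $b_{n,k}$, $1\le k<n$, on a common probability space, such that for all $1\le k<n$ $$\hat\gamma_{k}\overset{\mathcal D}{=}G_{n,k}+b_{n,k},\qquad G_{n,k}\sim\Gamma(k,\gamma/k)\quad\text{(shape } k,\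 \text{scale } \gamma/k),$$ and the following holds for the remainders. 1. For every sequence $k=k_n$ with $1\le k_n<n$ for all large $n$ and $k_n/n\to0$, we have $b_{n,k_n}\to0$ in probability as $n\to\infty$. 2. Let $c\in(0,1]$ be such that $U$ is continuous at $1/c$ with $U(1/c)>0$ (for $c=1$: such that the limit $\lim_{x\downarrow1}U(x)$ exists in $(0,\infty)$). Then there is a constant $b_c\in\mathbb R$ such that for every sequence $k=k_n$ with $1\le k_n<n$ for all large $n$ and $k_n/n\to c$, we have $b_{n,k_n}\to b_c$ in probability as $n\to\infty$. -/

import Mathlib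

open MeasureTheory ProbabilityTheory Filter Topology

noncomputable section

/-- The Fréchet distribution function with extreme value index `γ`:
`G_γ(x) = exp (-x ^ (-1/γ))` for `x > 0` and `G_γ(x) = 0` for `x ≤ 0`. -/
def frechetCDF (γ x : ℝ) : ℝ :=
  if 0 < x then Real.exp (-(x ^ (-1 / γ))) else 0

/-- `F ∈ DoA(G_γ)`: for suitable norming constants `a n > 0` and `b n`, the functions
`F ^ n (a n * x + b n)` converge to `G_γ(x)`, for every real `x`. -/
def InFrechetDoA (F : ℝ → ℝ) (γ : ℝ) : Prop :=
  ∃ a b : ℕ → ℝ, (∀ n, 0 < a n) ∧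
    ∀ x : ℝ, Tendsto (fun n : ℕ => F (a n * x + b n) ^ n) atTop (𝓝 (frechetCDF γ x))

/-- The tail quantile function `U(x) = F^←(1 - 1/x)`, `x > 1`, where
`F^←(p) = inf {y | p ≤ F y}` is the generalized inverse. -/
def tailQuantile (F : ℝ → ℝ) (x : ℝ) : ℝ :=
  sInf {y : ℝ | 1 - 1 / x ≤ F y}

/-- The `i`-th smallest value `x_(i,n)`, `1 ≤ i ≤ n`, of a sample `x` of size `n`
(so `x_(1,n) ≤ ⋯ ≤ x_(n,n)`); it is `0` for `i` out of range. -/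
def orderStat {n : ℕ} (x : Fin n → ℝ) (i : ℕ) : ℝ :=
  if h : 1 ≤ i ∧ i ≤ n then x (Tuple.sort x ⟨i - 1, by omega⟩) else 0

/-- The Hill estimator `(1/k) ∑_{i=1}^k log (x_(n-i+1,n) / x_(n-k,n))`, for `1 ≤ k < n`. -/
def hillEstimator {n : ℕ} (x : Fin n → ℝ) (k : ℕ) : ℝ :=
  (1 / (k : ℝ)) * ∑ i ∈ Finset.Icc 1 k, Real.log (orderStat x (n - i + 1) / orderStat x (n - k))

end

/-! Write Q(x) = U(e^x). If E is standard exponential then Q(E) has distribution function F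
(`map_expQuantile`), and Q commutes with order statistics of positive samples. By memorylessness,
given T = E_(n-k,n), the k larger exponentials exceed T by independent exponentials Z_i, up to a
random order (`map_pi_stdExp_sum_orderStat`). So the Hill estimator has the law of (1/k) ∑ log (Q(T
+ Z_i) / Q(T)) with T independent of the Z_i. Its main part is G = (γ/k) ∑ Z_i, which is Gamma
distributed, and b is what remains.

Equality in law is required only for each pair (n, k), so two independent exponential sequences
serve for all pairs: the first yields every threshold T, the second every Z_i. On this space both
remainder statements hold almost surely.

If k/n → 0 then T → ∞. The domain of attraction gives the Potter bound |log (Q(t + z) / Q(t)) - γ z|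
≤ ε (1 + z) for large t (`exists_potter_bound`); averaging over the Z_i, whose means are bounded,
yields b → 0 even when k stays bounded.

If k/n → c > 0 then T → -log c and k → ∞. Averages of log Q(T + Z_i) obey a law of large numbers
locally uniform in T, because log Q is monotone after truncation and its integrated version is
continuous in T (`tendsto_average_truncLogQuantile`). With u the limit of U at 1/c, this gives b_c =
E log Q(-log c + Z) - log u - γ E Z. -/

/-! ### Exponential and gamma laws. -/

/-- The standard exponential distribution. -/
noncomputable abbrev stdExp : Measure ℝ := expMeasure 1

instance : IsProbabilityMeasure stdExp := isProbabilityMeasure_expMeasure one_pos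

lemma cdf_stdExp (x : ℝ) : cdf stdExp x = if 0 ≤ x then 1 - Real.exp (-x) else 0 := by
  rw [cdf_expMeasure_eq one_pos]; simp

lemma stdExp_eq : stdExp = volume.withDensity
    (fun x => if 0 ≤ x then ENNReal.ofReal (Real.exp (-x)) else 0) := by
  unfold stdExp expMeasure gammaMeasure
  congr 1
  ext x
  rw [gammaPDF_eq]
  split_ifs <;> simp

instance : NullSingletonClass stdExp := by rw [stdExp_eq]; infer_instance

lemma measurable_stdExp_density :
    Measurable (fun x : ℝ => if 0 ≤ x then ENNReal.ofReal (Real.exp (-x)) else 0) :=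
  Measurable.ite measurableSet_Ici (by fun_prop) measurable_const

lemma stdExp_Iic_zero : stdExp (Set.Iic 0) = 0 := by
  rw [← ofReal_cdf, cdf_stdExp]; simp

lemma ae_stdExp_pos : ∀ᵐ x ∂stdExp, 0 < x := by
  rw [ae_iff]
  simpa [Set.Iic] using! stdExp_Iic_zero

/-- The memoryless property of the exponential distribution. -/
lemma stdExp_Ioi_inter {t : ℝ} (ht : 0 ≤ t) {s : Set ℝ} (hs : MeasurableSet s) :
    stdExp (Set.Ioi t ∩ s) = ENNReal.ofReal (Real.exp (-t)) * stdExp ((fun x => t + x) ⁻¹' s) := by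
  have hs' : MeasurableSet ((fun x => t + x) ⁻¹' s) := measurable_const_add t hs
  have h0 : stdExp ((fun x => t + x) ⁻¹' s) = stdExp (Set.Ioi 0 ∩ (fun x => t + x) ⁻¹' s) := by
    refine measure_congr ?_
    filter_upwards [ae_stdExp_pos] with x hx
    exact propext ⟨fun h => ⟨hx, h⟩, fun h => h.2⟩
  rw [h0, stdExp_eq, withDensity_apply _ (measurableSet_Ioi.inter hs),
    withDensity_apply _ (measurableSet_Ioi.inter hs'),
    ← lintegral_indicator (measurableSet_Ioi.inter hs),
    ← lintegral_indicator (measurableSet_Ioi.inter hs'),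
    ← lintegral_add_left_eq_self _ t, ← lintegral_const_mul]
  · refine lintegral_congr fun x => ?_
    by_cases hx : 0 < x ∧ t + x ∈ s
    · rw [Set.indicator_of_mem (show t + x ∈ Set.Ioi t ∩ s from ⟨by simpa using hx.1, hx.2⟩),
        Set.indicator_of_mem (show x ∈ Set.Ioi 0 ∩ (fun x => t + x) ⁻¹' s from hx),
        if_pos (by linarith [hx.1]), if_pos hx.1.le, ← ENNReal.ofReal_mul (Real.exp_nonneg _),
        ← Real.exp_add, neg_add]
    · rw [Set.indicator_of_notMem, Set.indicator_of_notMem, mul_zero]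
      · exact hx
      · rintro ⟨h1, h2⟩
        exact hx ⟨by simpa using h1, h2⟩
  · exact measurable_stdExp_density.indicator (measurableSet_Ioi.inter hs')

lemma stdExp_Ioi {t : ℝ} (ht : 0 ≤ t) : stdExp (Set.Ioi t) = ENNReal.ofReal (Real.exp (-t)) := by
  simpa using stdExp_Ioi_inter ht MeasurableSet.univ

lemma integrable_id_stdExp : Integrable (fun x : ℝ => x) stdExp := by
  rw [stdExp_eq, integrable_withDensity_iff measurable_stdExp_density
    (ae_of_all _ fun x => by split_ifs <;> simp)]
  have h : IntegrableOn (fun x : ℝ => Real.exp (-x) * x ^ ((2 : ℝ) - 1)) (Set.Ioi 0) :=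
    Real.GammaIntegral_convergent two_pos
  rw [← integrable_indicator_iff measurableSet_Ioi] at h
  refine h.congr (ae_of_all _ fun x => ?_)
  rcases lt_trichotomy x 0 with hx | rfl | hx
  · simp [Set.indicator, hx.not_gt, hx.not_ge]
  · simp
  · have : (2 : ℝ) - 1 = 1 := by norm_num
    simp [Set.indicator, hx, hx.le, this, ENNReal.toReal_ofReal (Real.exp_nonneg _), mul_comm]

/-- In the convolution at w the exponential factors multiply to exp (-w), leaving the integral of y
^ (a - 1) over [0, w]; this turns Γ(a) into Γ(a + 1). -/
lemma gammaMeasure_conv_stdExp {a : ℝ} (ha : 0 < a) :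
    (gammaMeasure a 1).conv stdExp = gammaMeasure (a + 1) 1 := by
  have hg : ∀ b : ℝ, Measurable (gammaPDF b 1) := fun b =>
    (measurable_gammaPDFReal b 1).ennreal_ofReal
  unfold stdExp expMeasure gammaMeasure
  rw [conv_withDensity_eq_lconvolution (hg a) (hg 1)]
  congr 1
  ext w
  rw [lconvolution_def]
  rcases lt_or_ge w 0 with hw | hw
  · rw [gammaPDF_of_neg hw, lintegral_eq_zero_iff' ]
    · refine ae_of_all _ fun y => ?_
      rcases lt_or_ge y 0 with hy | hy
      · simp [gammaPDF_of_neg hy]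
      · simp [gammaPDF_of_neg (show -y + w < 0 by linarith)]
    · have := hg a; have := hg 1
      fun_prop
  · have h1 : ∀ y, gammaPDF a 1 y * gammaPDF 1 1 (-y + w) =
        (Set.Icc 0 w).indicator (fun y => ENNReal.ofReal
          (Real.exp (-w) / Real.Gamma a * y ^ (a - 1))) y := by
      intro y
      by_cases hy : y ∈ Set.Icc 0 w
      · rw [Set.indicator_of_mem hy, gammaPDF_of_nonneg hy.1,
          gammaPDF_of_nonneg (by linarith [hy.2]), ← ENNReal.ofReal_mul]
        · congr 1
          have : Real.exp (-w) = Real.exp (-y) * Real.exp (-(-y + w)) := by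
            rw [← Real.exp_add]; congr 1; ring
          rw [this]
          simp
          ring
        · have := Real.Gamma_pos_of_pos ha
          have := Real.rpow_nonneg hy.1 (a - 1)
          positivity
      · rw [Set.indicator_of_notMem hy]
        rcases lt_or_ge y 0 with h | h
        · simp [gammaPDF_of_neg h]
        · have : w < y := by by_contra h'; exact hy ⟨h, not_lt.1 h'⟩
          simp [gammaPDF_of_neg (show -y + w < 0 by linarith)]
    have hG := Real.Gamma_pos_of_pos ha
    have hint : IntervalIntegrable (fun y => Real.exp (-w) / Real.Gamma a * y ^ (a - 1))
        volume 0 w := (intervalIntegral.intervalIntegrable_rpow' (by linarith)).const_mul _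
    simp_rw [h1]
    rw [lintegral_indicator measurableSet_Icc, setLIntegral_congr Ioc_ae_eq_Icc.symm,
      ← ofReal_integral_eq_lintegral_ofReal, ← intervalIntegral.integral_of_le hw,
      intervalIntegral.integral_const_mul, integral_rpow (Or.inl (by linarith)),
      gammaPDF_of_nonneg hw, Real.Gamma_add_one ha.ne']
    · congr 1
      have : (0 : ℝ) ^ (a - 1 + 1) = 0 := Real.zero_rpow (by linarith)
      rw [this]
      simp
      field_simp
    · exact (intervalIntegrable_iff_integrableOn_Ioc_of_le hw).1 hint
    · refine (ae_restrict_iff' measurableSet_Ioc).2 (ae_of_all _ fun y hy => ?_)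
      have := Real.rpow_nonneg hy.1.le (a - 1)
      show 0 ≤ _
      positivity

lemma map_mul_gammaMeasure {a c : ℝ} (hc : 0 < c) :
    (gammaMeasure a 1).map (fun x => c * x) = gammaMeasure a (1 / c) := by
  ext s hs
  have hm : Measurable (fun x : ℝ => c * x) := measurable_const_mul c
  rw [Measure.map_apply hm hs, gammaMeasure, gammaMeasure, withDensity_apply _ (hm hs),
    withDensity_apply _ hs, ← lintegral_indicator (hm hs), ← lintegral_indicator hs]
  have key : ∀ f : ℝ → ENNReal, Measurable f →
      ∫⁻ x, f x = ENNReal.ofReal c * ∫⁻ x, f (c * x) := by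
    intro f hf
    have h := Real.smul_map_volume_mul_left hc.ne'
    rw [abs_of_pos hc] at h
    nth_rw 1 [← h]
    rw [lintegral_smul_measure, lintegral_map hf hm, smul_eq_mul]
  have hg : Measurable (gammaPDF a (1 / c)) := (measurable_gammaPDFReal a _).ennreal_ofReal
  rw [key (s.indicator (gammaPDF a (1 / c))) (hg.indicator hs), ← lintegral_const_mul (ENNReal.ofReal c) (show Measurable fun x =>
      s.indicator (gammaPDF a (1 / c)) (c * x) from (hg.indicator hs).comp hm)]
  refine lintegral_congr fun x => ?_
  by_cases hx : c * x ∈ s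
  · rw [Set.indicator_of_mem hx, Set.indicator_of_mem (show x ∈ (fun x => c * x) ⁻¹' s from hx)]
    rcases lt_or_ge x 0 with h0 | h0
    · rw [gammaPDF_of_neg h0, gammaPDF_of_neg (mul_neg_of_pos_of_neg hc h0), mul_zero]
    · rw [gammaPDF_of_nonneg h0, gammaPDF_of_nonneg (by positivity), ← ENNReal.ofReal_mul hc.le]
      congr 1
      rw [Real.mul_rpow hc.le h0, Real.div_rpow zero_le_one hc.le, Real.rpow_sub hc,
        Real.rpow_one, Real.one_rpow]
      have := Real.rpow_pos_of_pos hc a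
      field_simp
  · rw [Set.indicator_of_notMem hx,
      Set.indicator_of_notMem (show x ∉ (fun x => c * x) ⁻¹' s from hx), mul_zero]

/-! ### Order statistics through counting. -/

/-- Counting removes the sorting permutation: measurability and the asymptotics of order statistics
both follow from it. -/
lemma orderStat_le_iff {n : ℕ} (x : Fin n → ℝ) {i : ℕ} (h1 : 1 ≤ i) (h2 : i ≤ n) (t : ℝ) :
    orderStat x i ≤ t ↔ i ≤ (Finset.univ.filter fun j => x j ≤ t).card := by
  have h := Tuple.lt_card_le_iff_apply_le_of_monotone (Tuple.monotone_sort x)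
    (j := ⟨i - 1, by omega⟩) (a := t)
  have hc : (Finset.univ.filter fun j => (x ∘ Tuple.sort x) j ≤ t).card =
      (Finset.univ.filter fun j => x j ≤ t).card :=
    Finset.card_equiv (Tuple.sort x) (by simp)
  rw [hc] at h
  rw [orderStat, dif_pos ⟨h1, h2⟩]
  change x _ ≤ t ↔ _
  rw [← Function.comp_apply (f := x), ← h]
  simp only
  omega

lemma orderStat_of_out_of_range {n : ℕ} (x : Fin n → ℝ) {i : ℕ} (h : ¬(1 ≤ i ∧ i ≤ n)) :
    orderStat x i = 0 := dif_neg h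

lemma measurable_orderStat {n : ℕ} (i : ℕ) : Measurable fun x : Fin n → ℝ => orderStat x i := by
  by_cases h : 1 ≤ i ∧ i ≤ n
  · refine measurable_of_Iic fun t => ?_
    have : (fun x : Fin n → ℝ => orderStat x i) ⁻¹' Set.Iic t =
        {x | i ≤ ∑ j, if x j ≤ t then 1 else 0} := by
      ext x
      simp [orderStat_le_iff x h.1 h.2]
    rw [this]
    refine measurableSet_le measurable_const (Finset.measurable_sum _ fun j _ => ?_)
    exact Measurable.ite (measurableSet_le (measurable_pi_apply j) measurable_const)
      measurable_const measurable_const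
  · simp_rw [orderStat_of_out_of_range _ h]
    exact measurable_const

lemma measurable_hillEstimator {n : ℕ} (k : ℕ) :
    Measurable fun x : Fin n → ℝ => hillEstimator x k := by
  unfold hillEstimator
  refine Measurable.const_mul (Finset.measurable_sum _ fun i _ => ?_) _
  exact Real.measurable_log.comp ((measurable_orderStat _).div (measurable_orderStat _))

/-! ### Rank events and memorylessness in several coordinates. -/

section Renyi

variable {m k : ℕ}

/-- Assembles a vector from a pivot, the `k` coordinates above and the `m` coordinates below it,
at the places prescribed by `τ`. -/
def assemble (τ : (Fin m ⊕ Fin 1) ⊕ Fin k ≃ Fin (m + 1 + k))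
    (p : ℝ × (Fin k → ℝ) × (Fin m → ℝ)) (i : Fin (m + 1 + k)) : ℝ :=
  Sum.elim (Sum.elim p.2.2 fun _ => p.1) p.2.1 (τ.symm i)

lemma measurable_assemble (τ : (Fin m ⊕ Fin 1) ⊕ Fin k ≃ Fin (m + 1 + k)) :
    Measurable (assemble τ) := by
  refine measurable_pi_lambda _ fun i => ?_
  unfold assemble
  rcases τ.symm i with (b | u) | a <;> simp only [Sum.elim_inl, Sum.elim_inr] <;> fun_prop

lemma map_assemble (ν : Measure ℝ) [IsProbabilityMeasure ν]
    (τ : (Fin m ⊕ Fin 1) ⊕ Fin k ≃ Fin (m + 1 + k)) :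
    (ν.prod ((Measure.pi fun _ : Fin k => ν).prod (Measure.pi fun _ : Fin m => ν))).map
      (assemble τ) = Measure.pi fun _ => ν := by
  refine (Measure.pi_eq fun s hs => ?_).symm
  rw [Measure.map_apply (measurable_assemble τ) (MeasurableSet.univ_pi hs)]
  have : assemble τ ⁻¹' Set.univ.pi s = s (τ (Sum.inl (Sum.inr 0))) ×ˢ
      ((Set.univ.pi fun a => s (τ (Sum.inr a))) ×ˢ
        (Set.univ.pi fun b => s (τ (Sum.inl (Sum.inl b))))) := by
    ext p
    simp only [Set.mem_preimage, Set.mem_pi, Set.mem_univ, true_imp_iff, Set.mem_prod]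
    rw [← τ.forall_congr_right]
    simp [assemble, Sum.forall]
    tauto
  rw [this, Measure.prod_prod, Measure.prod_prod, Measure.pi_pi, Measure.pi_pi,
    ← Equiv.prod_comp τ]
  simp only [Fintype.prod_sum_type, Finset.univ_unique, Finset.prod_singleton]
  rw [show (default : Fin 1) = 0 from rfl]
  ring

/-- The event that the coordinates in `S`, and only these, exceed the coordinate `j`. -/
def rankEvent {n : ℕ} (j : Fin n) (S : Finset (Fin n)) : Set (Fin n → ℝ) :=
  {x | ∀ i, (i ∈ S → x j < x i) ∧ (i ∉ S → i ≠ j → x i < x j)}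

lemma measurableSet_rankEvent {n : ℕ} (j : Fin n) (S : Finset (Fin n)) :
    MeasurableSet (rankEvent j S) := by
  have h : ∀ i l : Fin n, MeasurableSet {x : Fin n → ℝ | x i < x l} := fun i l =>
    measurableSet_lt (measurable_pi_apply i) (measurable_pi_apply l)
  simp only [rankEvent, Set.ofPred_forall, Set.ofPred_and]
  exact MeasurableSet.iInter fun i => (MeasurableSet.iInter fun _ => h _ _).inter
    (MeasurableSet.iInter fun _ => MeasurableSet.iInter fun _ => h _ _)

/-- The place of the pivot and the set of places above it. -/
def pivotLabel (τ : (Fin m ⊕ Fin 1) ⊕ Fin k ≃ Fin (m + 1 + k)) :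
    Fin (m + 1 + k) × Finset (Fin (m + 1 + k)) :=
  (τ (Sum.inl (Sum.inr 0)), Finset.univ.map (Function.Embedding.inr.trans τ.toEmbedding))

lemma card_pivotLabel (τ : (Fin m ⊕ Fin 1) ⊕ Fin k ≃ Fin (m + 1 + k)) :
    (pivotLabel τ).2.card = k := by simp [pivotLabel]

lemma mem_rankEvent_pivotLabel (τ : (Fin m ⊕ Fin 1) ⊕ Fin k ≃ Fin (m + 1 + k))
    (x : Fin (m + 1 + k) → ℝ) :
    x ∈ rankEvent (pivotLabel τ).1 (pivotLabel τ).2 ↔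
      (∀ a, x (τ (Sum.inl (Sum.inr 0))) < x (τ (Sum.inr a))) ∧
        ∀ b, x (τ (Sum.inl (Sum.inl b))) < x (τ (Sum.inl (Sum.inr 0))) := by
  simp only [rankEvent, Set.mem_ofPred_eq, pivotLabel]
  rw [← τ.forall_congr_right]
  simp [Sum.forall]
  tauto

/-- The set above a pivot is determined by the pivot, and its cardinality strictly decreases as the
pivot value grows, so equal cardinalities force equal pivots. -/
lemma rankEvent_unique {n : ℕ} {j j' : Fin n} {S S' : Finset (Fin n)} (hj : j ∉ S) (hj' : j' ∉ S')
    (hS : S.card = S'.card) {x : Fin n → ℝ} (hx : Function.Injective x)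
    (h : x ∈ rankEvent j S) (h' : x ∈ rankEvent j' S') : j = j' ∧ S = S' := by
  have key : ∀ {j : Fin n} {S : Finset (Fin n)}, j ∉ S → x ∈ rankEvent j S →
      S = Finset.univ.filter fun i => x j < x i := by
    intro j S hj h
    ext i
    simp only [Finset.mem_filter, Finset.mem_univ, true_and]
    refine ⟨(h i).1, fun hi => ?_⟩
    by_contra hn
    by_cases hij : i = j
    · exact absurd hi (by rw [hij]; exact lt_irrefl _)
    · exact absurd hi ((h i).2 hn hij).not_gt
  have h1 := key hj h
  have h2 := key hj' h'
  have aux : ∀ {a b : Fin n}, x a < x b → (Finset.univ.filter fun i => x b < x i).card <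
      (Finset.univ.filter fun i => x a < x i).card := by
    intro a b hab
    refine Finset.card_lt_card ((Finset.ssubset_iff_of_subset fun i hi => ?_).2 ⟨b, ?_, ?_⟩)
    · simp only [Finset.mem_filter, Finset.mem_univ, true_and] at hi ⊢
      exact hab.trans hi
    · simpa using hab
    · simp
  have hxj : x j = x j' := by
    rw [h1, h2] at hS
    rcases lt_trichotomy (x j) (x j') with hl | hl | hl
    · exact absurd hS (aux hl).ne'
    · exact hl
    · exact absurd hS (aux hl).ne
  refine ⟨hx hxj, ?_⟩
  rw [h1, h2, hxj]

lemma pivotLabel_notMem (τ : (Fin m ⊕ Fin 1) ⊕ Fin k ≃ Fin (m + 1 + k)) :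
    (pivotLabel τ).1 ∉ (pivotLabel τ).2 := by
  simp [pivotLabel]

lemma pi_stdExp_shift {t : ℝ} (ht : 0 ≤ t) {s : Set (Fin k → ℝ)} (hs : MeasurableSet s) :
    Measure.pi (fun _ : Fin k => stdExp) ({z | ∀ a, t < z a} ∩ s) =
      ENNReal.ofReal (Real.exp (-t)) ^ k *
        Measure.pi (fun _ : Fin k => stdExp) {z | (fun a => t + z a) ∈ s} := by
  have hU : MeasurableSet {z : Fin k → ℝ | ∀ a, t < z a} := by
    simp only [Set.ofPred_forall]
    exact MeasurableSet.iInter fun a => measurableSet_lt measurable_const (measurable_pi_apply a)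
  have hm : Measurable fun (z : Fin k → ℝ) a => t + z a := by fun_prop
  have hE0 : ENNReal.ofReal (Real.exp (-t)) ^ k ≠ 0 := by
    refine pow_ne_zero _ ?_
    simp [Real.exp_pos]
  have hE1 : ENNReal.ofReal (Real.exp (-t)) ^ k ≠ ⊤ := ENNReal.pow_ne_top ENNReal.ofReal_ne_top
  have hpi : Measure.pi (fun _ : Fin k => stdExp.map fun x => t + x) =
      (Measure.pi fun _ : Fin k => stdExp).map fun z a => t + z a := by
    have := fun _ : Fin k => Measure.isProbabilityMeasure_map (μ := stdExp)
      (measurable_const_add t).aemeasurable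
    exact (Measure.pi_map_pi fun _ => (measurable_const_add t).aemeasurable).symm
  have := Measure.isProbabilityMeasure_map (μ := stdExp) (measurable_const_add t).aemeasurable
  -- The shifted law is the law conditioned on all coordinates exceeding t; on boxes this is
  -- one-dimensional memorylessness in each coordinate.
  have h : Measure.pi (fun _ : Fin k => stdExp.map fun x => t + x) =
      (ENNReal.ofReal (Real.exp (-t)) ^ k)⁻¹ •
        (Measure.pi fun _ : Fin k => stdExp).restrict {z | ∀ a, t < z a} := by
    refine Measure.pi_eq fun s hs => ?_
    rw [Measure.smul_apply, Measure.restrict_apply (MeasurableSet.univ_pi hs)]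
    have : Set.univ.pi s ∩ {z : Fin k → ℝ | ∀ a, t < z a} =
        Set.univ.pi fun a => Set.Ioi t ∩ s a := by
      ext z
      simp only [Set.mem_inter_iff, Set.mem_pi, Set.mem_univ, true_imp_iff, Set.mem_ofPred_eq,
        Set.mem_Ioi]
      exact ⟨fun h a => ⟨h.2 a, h.1 a⟩, fun h => ⟨fun a => (h a).2, fun a => (h a).1⟩⟩
    rw [this, Measure.pi_pi]
    simp_rw [stdExp_Ioi_inter ht (hs _), Finset.prod_mul_distrib]
    rw [Finset.prod_const, Finset.card_univ, Fintype.card_fin, smul_eq_mul, ← mul_assoc,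
      ENNReal.inv_mul_cancel hE0 hE1, one_mul]
    exact Finset.prod_congr rfl fun a _ => (Measure.map_apply (measurable_const_add t) (hs a)).symm
  have h2 := congrArg (fun ν => ν s) (hpi.symm.trans h)
  simp only [Measure.smul_apply, smul_eq_mul] at h2
  rw [Measure.map_apply hm hs, Measure.restrict_apply hs, Set.inter_comm] at h2
  change _ = _ * Measure.pi (fun _ : Fin k => stdExp) ((fun z a => t + z a) ⁻¹' s)
  rw [h2, ← mul_assoc, ENNReal.mul_inv_cancel hE0 hE1, one_mul]

end Renyi

/-! ### Rényi's representation. -/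

section Renyi

variable {m k : ℕ}

/-- The density of the pivot, relative to the exponential distribution, on a `rankEvent`. -/
noncomputable def pivotWeight (m k : ℕ) (t : ℝ) : ENNReal :=
  stdExp (Set.Iio t) ^ m * ENNReal.ofReal (Real.exp (-t)) ^ k

lemma measurable_pivotWeight : Measurable (pivotWeight m k) := by
  have h : Measurable fun t : ℝ => stdExp (Set.Iio t) :=
    Monotone.measurable fun a b hab => measure_mono (Set.Iio_subset_Iio hab)
  unfold pivotWeight
  exact (h.pow_const _).mul ((by fun_prop : Measurable fun t : ℝ =>
    ENNReal.ofReal (Real.exp (-t))).pow_const _)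

/-- The pivot together with the sum of `φ pivot` over the coordinates in `S`. -/
def pivotSum (φ : ℝ → ℝ → ℝ) {n : ℕ} (l : Fin n × Finset (Fin n)) (x : Fin n → ℝ) : ℝ × ℝ :=
  (x l.1, ∑ i ∈ l.2, φ (x l.1) (x i))

lemma measurable_pivotSum {φ : ℝ → ℝ → ℝ} (hφ : Measurable (Function.uncurry φ)) {n : ℕ}
    (l : Fin n × Finset (Fin n)) : Measurable (pivotSum φ l) := by
  refine (measurable_pi_apply _).prodMk (Finset.measurable_sum _ fun i _ => ?_)
  exact hφ.comp (f := fun x : Fin n → ℝ => (x l.1, x i))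
    ((measurable_pi_apply l.1).prodMk (measurable_pi_apply i))

lemma measurable_shiftedSum {φ : ℝ → ℝ → ℝ} (hφ : Measurable (Function.uncurry φ)) :
    Measurable fun p : ℝ × (Fin k → ℝ) => ∑ a, φ p.1 (p.1 + p.2 a) := by
  refine Finset.measurable_sum _ fun a _ => ?_
  exact hφ.comp (measurable_fst.prodMk
    (measurable_fst.add ((measurable_pi_apply a).comp measurable_snd)))

/-- Fubini over the pivot value t: the m lower coordinates contribute a power of P(E < t), the k
upper ones are shifted by memorylessness. The right side does not depend on `τ`, so all labels
contribute equally. -/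
lemma pi_rankEvent_inter {φ : ℝ → ℝ → ℝ} (hφ : Measurable (Function.uncurry φ))
    (τ : (Fin m ⊕ Fin 1) ⊕ Fin k ≃ Fin (m + 1 + k)) {C : Set (ℝ × ℝ)} (hC : MeasurableSet C) :
    Measure.pi (fun _ => stdExp) (rankEvent (pivotLabel τ).1 (pivotLabel τ).2 ∩
      pivotSum φ (pivotLabel τ) ⁻¹' C) =
    ∫⁻ t, pivotWeight m k t * Measure.pi (fun _ : Fin k => stdExp)
      {z | (t, ∑ a, φ t (t + z a)) ∈ C} ∂stdExp := by
  have hM : MeasurableSet (rankEvent (pivotLabel τ).1 (pivotLabel τ).2 ∩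
      pivotSum φ (pivotLabel τ) ⁻¹' C) :=
    (measurableSet_rankEvent _ _).inter (measurable_pivotSum hφ _ hC)
  rw [← map_assemble stdExp τ, Measure.map_apply (measurable_assemble τ) hM,
    Measure.prod_apply (measurable_assemble τ hM)]
  refine lintegral_congr_ae ?_
  filter_upwards [ae_stdExp_pos] with t ht
  have hset : Prod.mk t ⁻¹' (assemble τ ⁻¹' (rankEvent (pivotLabel τ).1 (pivotLabel τ).2 ∩
      pivotSum φ (pivotLabel τ) ⁻¹' C)) =
      ({z : Fin k → ℝ | ∀ a, t < z a} ∩ {z | (t, ∑ a, φ t (z a)) ∈ C}) ×ˢ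
        (Set.univ.pi fun _ : Fin m => Set.Iio t) := by
    ext ⟨z, y⟩
    rw [Set.mem_preimage, Set.mem_preimage, Set.mem_inter_iff, mem_rankEvent_pivotLabel]
    simp only [Set.mem_preimage, Set.mem_inter_iff, Set.mem_prod,
      Set.mem_ofPred_eq, Set.mem_pi, Set.mem_univ, true_imp_iff, Set.mem_Iio, assemble, pivotSum,
      pivotLabel, Finset.sum_map, Function.Embedding.trans_apply, Equiv.coe_toEmbedding,
      Function.Embedding.inr_apply, Equiv.symm_apply_apply, Sum.elim_inl, Sum.elim_inr]
    tauto
  have hms : MeasurableSet {z : Fin k → ℝ | (t, ∑ a, φ t (z a)) ∈ C} := by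
    refine hC.preimage (measurable_const.prodMk (Finset.measurable_sum _ fun a _ => ?_))
    exact hφ.comp (measurable_const.prodMk (measurable_pi_apply a))
  rw [hset, Measure.prod_prod, pi_stdExp_shift ht.le hms, Measure.pi_pi, Finset.prod_const,
    Finset.card_univ, Fintype.card_fin, pivotWeight]
  simp only [Set.mem_ofPred_eq]
  ring

/-- The labelling of a sorted vector. -/
def sortedLabelling (m k : ℕ) : (Fin m ⊕ Fin 1) ⊕ Fin k ≃ Fin (m + 1 + k) :=
  (Equiv.sumCongr finSumFinEquiv (Equiv.refl _)).trans finSumFinEquiv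

lemma orderStat_eq_comp_sort {n : ℕ} (x : Fin n → ℝ) (i : Fin n) :
    orderStat x (i + 1) = x (Tuple.sort x i) := by
  rw [orderStat, dif_pos ⟨by omega, by omega⟩]
  simp

lemma mem_rankEvent_sort {x : Fin (m + 1 + k) → ℝ} (hx : Function.Injective x) :
    x ∈ rankEvent (pivotLabel ((sortedLabelling m k).trans (Tuple.sort x))).1
      (pivotLabel ((sortedLabelling m k).trans (Tuple.sort x))).2 := by
  have hs : StrictMono (x ∘ Tuple.sort x) :=
    (Tuple.monotone_sort x).strictMono_of_injective (hx.comp (Tuple.sort x).injective)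
  rw [mem_rankEvent_pivotLabel]
  constructor
  · exact fun a => hs (by rw [Fin.lt_def]; simp [sortedLabelling]; omega)
  · exact fun b => hs (by rw [Fin.lt_def]; simp [sortedLabelling])

lemma pivotSum_sort (φ : ℝ → ℝ → ℝ) (x : Fin (m + 1 + k) → ℝ) :
    pivotSum φ (pivotLabel ((sortedLabelling m k).trans (Tuple.sort x))) x =
      (orderStat x (m + 1), ∑ i ∈ Finset.Icc 1 k,
        φ (orderStat x (m + 1)) (orderStat x (m + 1 + k - i + 1))) := by
  have h1 : orderStat x (m + 1) = x (Tuple.sort x ⟨m, by omega⟩) :=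
    orderStat_eq_comp_sort x ⟨m, by omega⟩
  have h2 : sortedLabelling m k (Sum.inl (Sum.inr 0)) = ⟨m, by omega⟩ := by
    ext; simp [sortedLabelling]
  simp only [pivotSum, pivotLabel, Equiv.trans_apply, Finset.sum_map,
    Function.Embedding.trans_apply, Function.Embedding.inr_apply, Equiv.coe_toEmbedding, h2, ← h1]
  congr 1
  have h3 : ∑ i ∈ Finset.Icc 1 k, φ (orderStat x (m + 1)) (orderStat x (m + 1 + k - i + 1)) =
      ∑ i ∈ Finset.range k, φ (orderStat x (m + 1)) (orderStat x (m + 1 + i + 1)) := by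
    refine Finset.sum_bij' (fun i _ => k - i) (fun i _ => k - i) ?_ ?_ ?_ ?_ ?_
    · intro i hi; simp only [Finset.mem_Icc, Finset.mem_range] at *; omega
    · intro i hi; simp only [Finset.mem_Icc, Finset.mem_range] at *; omega
    · intro i hi; simp only [Finset.mem_Icc] at *; omega
    · intro i hi; simp only [Finset.mem_range] at *; omega
    · intro i hi
      simp only [Finset.mem_Icc] at hi
      congr 2
      omega
  rw [h3, Finset.sum_range]
  refine Finset.sum_congr rfl fun a _ => ?_
  rw [show m + 1 + (a : ℕ) + 1 = ((sortedLabelling m k (Sum.inr a) : Fin _) : ℕ) + 1 by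
    simp [sortedLabelling], orderStat_eq_comp_sort]

lemma ae_pi_stdExp_injective (n : ℕ) :
    ∀ᵐ x ∂(Measure.pi fun _ : Fin n => stdExp), Function.Injective x := by
  have h : ∀ i j : Fin n, i ≠ j → ∀ᵐ x ∂(Measure.pi fun _ : Fin n => stdExp), x i ≠ x j := by
    intro i j hij
    have hind := (iIndepFun_pi (μ := fun _ : Fin n => stdExp) (X := fun _ x => x)
      fun _ => aemeasurable_id).indepFun hij
    rw [indepFun_iff_map_prod_eq_prod_map_map (measurable_pi_apply i).aemeasurable
      (measurable_pi_apply j).aemeasurable] at hind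
    have hm : ∀ i : Fin n, (Measure.pi fun _ : Fin n => stdExp).map (fun x => x i) = stdExp :=
      fun i => (measurePreserving_eval (fun _ : Fin n => stdExp) i).map_eq
    rw [hm, hm] at hind
    have hd : (stdExp.prod stdExp) {p : ℝ × ℝ | p.1 = p.2} = 0 := by
      rw [Measure.measure_prod_null (measurableSet_eq_fun measurable_fst measurable_snd)]
      refine ae_of_all _ fun t => ?_
      have : Prod.mk t ⁻¹' {p : ℝ × ℝ | p.1 = p.2} = {t} := by
        ext y; simp [eq_comm]
      change stdExp (Prod.mk t ⁻¹' {p : ℝ × ℝ | p.1 = p.2}) = 0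
      rw [this]
      simp
    rw [ae_iff]
    rw [← hind, Measure.map_apply (by fun_prop)
      (measurableSet_eq_fun measurable_fst measurable_snd)] at hd
    simpa using! hd
  have h' : ∀ᵐ x ∂(Measure.pi fun _ : Fin n => stdExp), ∀ i j : Fin n, i ≠ j → x i ≠ x j := by
    simp only [ae_all_iff]
    exact h
  filter_upwards [h'] with x hx i j hij
  by_contra hne
  exact hx i j hne hij

/-- Joint law of the `k + 1` largest of `m + 1 + k` exponential variables. -/
lemma pi_stdExp_orderStat {φ : ℝ → ℝ → ℝ} (hφ : Measurable (Function.uncurry φ)) (m k : ℕ)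
    {C : Set (ℝ × ℝ)} (hC : MeasurableSet C) :
    Measure.pi (fun _ : Fin (m + 1 + k) => stdExp) {x | (orderStat x (m + 1),
      ∑ i ∈ Finset.Icc 1 k, φ (orderStat x (m + 1)) (orderStat x (m + 1 + k - i + 1))) ∈ C} =
    ((Finset.univ.image (pivotLabel (m := m) (k := k))).card : ENNReal) *
      ∫⁻ t, pivotWeight m k t * Measure.pi (fun _ : Fin k => stdExp)
        {z | (t, ∑ a, φ t (t + z a)) ∈ C} ∂stdExp := by
  classical
  set B : Set (Fin (m + 1 + k) → ℝ) := {x | (orderStat x (m + 1),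
    ∑ i ∈ Finset.Icc 1 k, φ (orderStat x (m + 1)) (orderStat x (m + 1 + k - i + 1))) ∈ C} with hBdef
  have hB : MeasurableSet B := by
    refine hC.preimage ((measurable_orderStat _).prodMk (Finset.measurable_sum _ fun i _ => ?_))
    exact hφ.comp ((measurable_orderStat _).prodMk (measurable_orderStat _))
  have hM : ∀ l, MeasurableSet (rankEvent l.1 l.2 ∩ pivotSum φ l ⁻¹' C :
      Set (Fin (m + 1 + k) → ℝ)) := fun l =>
    (measurableSet_rankEvent _ _).inter (measurable_pivotSum hφ _ hC)
  calc Measure.pi (fun _ : Fin (m + 1 + k) => stdExp) B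
      = ∫⁻ x, B.indicator 1 x ∂(Measure.pi fun _ => stdExp) := (lintegral_indicator_one hB).symm
    -- Almost surely there are no ties, so exactly one label describes the sample, namely the one
    -- read off from its sorting permutation.
    _ = ∫⁻ x, ∑ l ∈ Finset.univ.image (pivotLabel (m := m) (k := k)),
          (rankEvent l.1 l.2 ∩ pivotSum φ l ⁻¹' C).indicator 1 x
          ∂(Measure.pi fun _ => stdExp) := by
        refine lintegral_congr_ae ?_
        filter_upwards [ae_pi_stdExp_injective (m + 1 + k)] with x hx
        set τ := (sortedLabelling m k).trans (Tuple.sort x) with hτ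
        have h1 := mem_rankEvent_sort hx
        have h2 := pivotSum_sort φ x
        rw [← hτ] at h1 h2
        rw [Finset.sum_eq_single (pivotLabel τ)]
        · by_cases hxB : x ∈ B
          · rw [Set.indicator_of_mem hxB, Set.indicator_of_mem]
            exact ⟨h1, by rw [Set.mem_preimage, h2]; exact hxB⟩
          · rw [Set.indicator_of_notMem hxB, Set.indicator_of_notMem]
            rintro ⟨-, h3⟩
            rw [Set.mem_preimage, h2] at h3
            exact hxB h3
        · intro l hl hne
          obtain ⟨τ', -, rfl⟩ := Finset.mem_image.1 hl
          refine Set.indicator_of_notMem (fun h3 => hne ?_) _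
          have := rankEvent_unique (pivotLabel_notMem τ') (pivotLabel_notMem τ)
            (by rw [card_pivotLabel, card_pivotLabel]) hx h3.1 h1
          exact Prod.ext this.1 this.2
        · intro h
          exact absurd (Finset.mem_image_of_mem _ (Finset.mem_univ τ)) h
    _ = ∑ l ∈ Finset.univ.image (pivotLabel (m := m) (k := k)),
          Measure.pi (fun _ => stdExp) (rankEvent l.1 l.2 ∩ pivotSum φ l ⁻¹' C) := by
        rw [lintegral_finsetSum _ fun l _ => measurable_one.indicator (hM l)]
        exact Finset.sum_congr rfl fun l _ => lintegral_indicator_one (hM l)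
    _ = _ := by
        rw [Finset.sum_congr rfl fun l hl => ?_, Finset.sum_const, nsmul_eq_mul]
        obtain ⟨τ, -, rfl⟩ := Finset.mem_image.1 hl
        exact pi_rankEvent_inter hφ τ hC

/-- Rényi's representation: given the `(m+1)`-th smallest of `m + 1 + k` exponential variables,
the excesses of the `k` larger ones are, in random order, independent exponential variables. -/
theorem map_pi_stdExp_sum_orderStat {φ : ℝ → ℝ → ℝ} (hφ : Measurable (Function.uncurry φ))
    (m k : ℕ) :
    (Measure.pi fun _ : Fin (m + 1 + k) => stdExp).map (fun x => ∑ i ∈ Finset.Icc 1 k,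
      φ (orderStat x (m + 1)) (orderStat x (m + 1 + k - i + 1))) =
    (((Measure.pi fun _ : Fin (m + 1 + k) => stdExp).map fun x => orderStat x (m + 1)).prod
      (Measure.pi fun _ : Fin k => stdExp)).map fun p => ∑ a, φ p.1 (p.1 + p.2 a) := by
  -- The number of labels need not be computed: the same constant appears in the density of the
  -- pivot.
  set K : ENNReal := ((Finset.univ.image (pivotLabel (m := m) (k := k))).card : ENNReal) with hK
  have hT : (Measure.pi fun _ : Fin (m + 1 + k) => stdExp).map (fun x => orderStat x (m + 1)) =
      stdExp.withDensity fun t => K * pivotWeight m k t := by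
    ext B hB
    have h := pi_stdExp_orderStat hφ m k (hB.prod MeasurableSet.univ)
    simp only [Set.mem_prod, Set.mem_univ, and_true] at h
    rw [Measure.map_apply (measurable_orderStat _) hB, withDensity_apply _ hB,
      lintegral_const_mul _ measurable_pivotWeight, ← lintegral_indicator hB]
    refine h.trans (congrArg _ (lintegral_congr fun t => ?_))
    by_cases ht : t ∈ B <;> simp [ht]
  have hm := measurable_shiftedSum (k := k) hφ
  ext D hD
  rw [Measure.map_apply _ hD, Measure.map_apply hm hD, Measure.prod_apply (hm hD), hT,
    lintegral_withDensity_eq_lintegral_mul _ (measurable_pivotWeight.const_mul K)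
      (measurable_measure_prodMk_left (hm hD))]
  · have h := pi_stdExp_orderStat hφ m k (MeasurableSet.univ.prod hD)
    simp only [Set.mem_prod, Set.mem_univ, true_and] at h
    refine h.trans ?_
    rw [← lintegral_const_mul']
    · refine lintegral_congr fun t => ?_
      rw [Pi.mul_apply, mul_assoc]
      rfl
    · exact ENNReal.natCast_ne_top _
  · refine Finset.measurable_sum _ fun i _ => ?_
    exact hφ.comp ((measurable_orderStat _).prodMk (measurable_orderStat _))

end Renyi

/-! ### Quantile transform from exponential samples. -/

section Quantile

variable (μ : Measure ℝ)

/-- The tail quantile function in logarithmic scale. -/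
noncomputable def expQuantile (x : ℝ) : ℝ := tailQuantile (cdf μ) (Real.exp x)

variable {μ}

/-- Right continuity of the distribution function puts the infimum in the set. With 1 < x the level
lies strictly between 0 and 1, so the set is nonempty and bounded below and `sInf` takes no default
value. -/
lemma tailQuantile_le_iff {x y : ℝ} (hx : 1 < x) :
    tailQuantile (cdf μ) x ≤ y ↔ 1 - 1 / x ≤ cdf μ y := by
  set S : Set ℝ := {y | 1 - 1 / x ≤ cdf μ y} with hS
  have hx0 : 0 < x := by linarith
  have hp1 : 1 - 1 / x < 1 := by
    have : 0 < 1 / x := by positivity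
    linarith
  have hp0 : 0 < 1 - 1 / x := by
    have : 1 / x < 1 := (div_lt_one hx0).2 hx
    linarith
  have hne : S.Nonempty := by
    obtain ⟨z, hz⟩ := ((tendsto_cdf_atTop μ).eventually (lt_mem_nhds hp1)).exists
    exact ⟨z, hz.le⟩
  have hbdd : BddBelow S := by
    obtain ⟨z, hz⟩ := ((tendsto_cdf_atBot μ).eventually (gt_mem_nhds hp0)).exists
    refine ⟨z, fun w hw => ?_⟩
    by_contra h
    exact absurd (hw.trans (monotone_cdf μ (not_le.1 h).le)) (not_le.2 hz)
  refine ⟨fun h => ?_, fun h => csInf_le hbdd h⟩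
  refine le_trans ?_ (monotone_cdf μ h)
  rw [← (cdf μ).iInf_Ioi_eq]
  refine le_ciInf fun ⟨r, hr⟩ => ?_
  obtain ⟨z, hz, hzr⟩ := exists_lt_of_csInf_lt hne hr
  exact le_trans hz (monotone_cdf μ hzr.le)

lemma expQuantile_le_iff {x y : ℝ} (hx : 0 < x) :
    expQuantile μ x ≤ y ↔ 1 - Real.exp (-x) ≤ cdf μ y := by
  rw [expQuantile, tailQuantile_le_iff (Real.one_lt_exp_iff.2 hx), one_div, Real.exp_neg]

lemma expQuantile_mono {x y : ℝ} (hx : 0 < x) (hxy : x ≤ y) :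
    expQuantile μ x ≤ expQuantile μ y := by
  rw [expQuantile_le_iff hx]
  have h := (expQuantile_le_iff (μ := μ) (hx.trans_le hxy)).1 le_rfl
  have : Real.exp (-y) ≤ Real.exp (-x) := Real.exp_le_exp.2 (by linarith)
  linarith

lemma expQuantile_of_nonpos {x : ℝ} (hx : x ≤ 0) : expQuantile μ x = 0 := by
  have : {y : ℝ | 1 - 1 / Real.exp x ≤ cdf μ y} = Set.univ := by
    refine Set.eq_univ_of_forall fun y => ?_
    have h1 : 1 ≤ 1 / Real.exp x := by
      rw [one_div, ← Real.exp_neg]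
      exact Real.one_le_exp (by linarith)
    have := cdf_nonneg μ y
    change 1 - 1 / Real.exp x ≤ cdf μ y
    linarith
  rw [expQuantile, tailQuantile, this, Real.sInf_univ]

lemma measurable_expQuantile : Measurable (expQuantile μ) := by
  refine measurable_of_Iic fun y => ?_
  have : expQuantile μ ⁻¹' Set.Iic y =
      (Set.Ioi 0 ∩ {x | 1 - Real.exp (-x) ≤ cdf μ y}) ∪ (Set.Iic 0 ∩ {_x | (0 : ℝ) ≤ y}) := by
    ext x
    simp only [Set.mem_preimage, Set.mem_Iic, Set.mem_union, Set.mem_inter_iff, Set.mem_Ioi,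
      Set.mem_ofPred_eq]
    rcases lt_or_ge 0 x with h | h
    · simp [expQuantile_le_iff h, h, h.not_ge]
    · simp [expQuantile_of_nonpos h, h, h.not_gt]
  rw [this]
  refine (measurableSet_Ioi.inter (measurableSet_le ?_ measurable_const)).union
    (measurableSet_Iic.inter (MeasurableSet.const _))
  fun_prop

lemma map_expQuantile [IsProbabilityMeasure μ] : stdExp.map (expQuantile μ) = μ := by
  have := Measure.isProbabilityMeasure_map (μ := stdExp)
    (measurable_expQuantile (μ := μ)).aemeasurable
  refine Measure.ext_of_Iic _ _ fun y => ?_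
  rw [Measure.map_apply measurable_expQuantile measurableSet_Iic, ← ofReal_cdf μ y]
  -- When the distribution function equals 1 at y, the threshold -log (1 - F(y)) is infinite,
  -- whereas `Real.log 0 = 0`.
  rcases (cdf_le_one μ y).lt_or_eq with hp | hp
  · have h0 := cdf_nonneg μ y
    have h1 : 0 ≤ -Real.log (1 - cdf μ y) := by
      have := Real.log_nonpos (by linarith : 0 ≤ 1 - cdf μ y) (by linarith)
      linarith
    have h : expQuantile μ ⁻¹' Set.Iic y =ᵐ[stdExp] Set.Iic (-Real.log (1 - cdf μ y)) := by
      filter_upwards [ae_stdExp_pos] with x hx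
      refine propext ?_
      change expQuantile μ x ≤ y ↔ x ≤ -Real.log (1 - cdf μ y)
      rw [expQuantile_le_iff hx, le_neg, Real.log_le_iff_le_exp (by linarith)]
      constructor <;> intro <;> linarith
    rw [measure_congr h, ← ofReal_cdf, cdf_stdExp, if_pos h1, neg_neg,
      Real.exp_log (by linarith)]
    congr 1
    ring
  · rw [hp, ENNReal.ofReal_one, prob_compl_eq_zero_iff
      (measurable_expQuantile measurableSet_Iic) |>.1]
    rw [← mem_ae_iff]
    filter_upwards [ae_stdExp_pos] with x hx
    rw [Set.mem_preimage, Set.mem_Iic, expQuantile_le_iff hx, hp]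
    linarith [Real.exp_pos (-x)]

lemma orderStat_expQuantile {n : ℕ} {x : Fin n → ℝ} (hx : ∀ j, 0 < x j) {i : ℕ} (h1 : 1 ≤ i)
    (h2 : i ≤ n) :
    orderStat (fun j => expQuantile μ (x j)) i = expQuantile μ (orderStat x i) := by
  have hmono : Monotone ((fun j => expQuantile μ (x j)) ∘ Tuple.sort x) := fun a b hab =>
    expQuantile_mono (hx _) (Tuple.monotone_sort x hab)
  have h := congrFun (Tuple.comp_sort_eq_comp_iff_monotone.2 hmono) ⟨i - 1, by omega⟩
  rw [orderStat, dif_pos ⟨h1, h2⟩, orderStat, dif_pos ⟨h1, h2⟩]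
  exact h.symm

lemma hillEstimator_expQuantile {n k : ℕ} (hkn : k < n) {x : Fin n → ℝ}
    (hx : ∀ j, 0 < x j) :
    hillEstimator (fun j => expQuantile μ (x j)) k = ∑ i ∈ Finset.Icc 1 k, (1 / (k : ℝ)) *
      Real.log (expQuantile μ (orderStat x (n - i + 1)) / expQuantile μ (orderStat x (n - k))) := by
  rw [hillEstimator, Finset.mul_sum]
  refine Finset.sum_congr rfl fun i hi => ?_
  rw [Finset.mem_Icc] at hi
  rw [orderStat_expQuantile hx (by omega) (by omega),
    orderStat_expQuantile hx (by omega) (by omega)]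

lemma ae_pi_stdExp_pos (n : ℕ) : ∀ᵐ x ∂(Measure.pi fun _ : Fin n => stdExp), ∀ j, 0 < x j := by
  rw [ae_all_iff]
  exact fun j => (measurePreserving_eval (fun _ : Fin n => stdExp) j).quasiMeasurePreserving.ae
    ae_stdExp_pos

/-- The law of the Hill estimator, in terms of an exponential order statistic and independent
exponential variables. -/
lemma map_hillEstimator {Ω : Type*} [MeasurableSpace Ω] {P : Measure Ω} [IsProbabilityMeasure P]
    [IsProbabilityMeasure μ] {X : ℕ → Ω → ℝ} (hlaw : ∀ i, HasLaw (X i) μ P)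
    (hindep : iIndepFun X P) {n k : ℕ} (hkn : k < n) :
    HasLaw (fun ω => hillEstimator (fun i : Fin n => X i ω) k)
      ((((Measure.pi fun _ : Fin n => stdExp).map fun x => orderStat x (n - k)).prod
        (Measure.pi fun _ : Fin k => stdExp)).map fun p => ∑ a, (1 / (k : ℝ)) *
          Real.log (expQuantile μ (p.1 + p.2 a) / expQuantile μ p.1)) P := by
  have hX : HasLaw (fun ω (i : Fin n) => X i ω) (Measure.pi fun _ => μ) P :=
    (iIndepFun.precomp Fin.val_injective hindep).hasLaw_pi fun i => hlaw i
  have hH : HasLaw (fun x : Fin n → ℝ => hillEstimator x k)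
      ((Measure.pi fun _ : Fin n => μ).map fun x => hillEstimator x k) (Measure.pi fun _ => μ) :=
    ⟨(measurable_hillEstimator k).aemeasurable, rfl⟩
  convert! hH.fun_comp hX using 1
  have hq : (Measure.pi fun _ : Fin n => μ) =
      (Measure.pi fun _ : Fin n => stdExp).map fun x j => expQuantile μ (x j) := by
    have : ∀ _ : Fin n, IsProbabilityMeasure (stdExp.map (expQuantile μ)) := fun _ =>
      Measure.isProbabilityMeasure_map measurable_expQuantile.aemeasurable
    have h := Measure.pi_map_pi (μ := fun _ : Fin n => stdExp) (f := fun _ => expQuantile μ)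
      fun _ => measurable_expQuantile.aemeasurable
    simp_rw [map_expQuantile] at h
    exact h.symm
  have hqm : Measurable fun (x : Fin n → ℝ) j => expQuantile μ (x j) :=
    measurable_pi_lambda _ fun j => measurable_expQuantile.comp (measurable_pi_apply j)
  rw [hq, Measure.map_map (measurable_hillEstimator k) hqm]
  -- m observations lie below the pivot, which has rank n - k = m + 1.
  obtain ⟨m, rfl⟩ : ∃ m, n = m + 1 + k := ⟨n - 1 - k, by omega⟩
  have hφ : Measurable (Function.uncurry fun t s =>
      (1 / (k : ℝ)) * Real.log (expQuantile μ s / expQuantile μ t)) :=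
    (Real.measurable_log.comp ((measurable_expQuantile.comp measurable_snd).div
      (measurable_expQuantile.comp measurable_fst))).const_mul _
  rw [show m + 1 + k - k = m + 1 by omega, ← map_pi_stdExp_sum_orderStat hφ m k]
  refine Measure.map_congr ?_
  filter_upwards [ae_pi_stdExp_pos (m + 1 + k)] with x hx
  rw [Function.comp_apply, hillEstimator_expQuantile hkn hx, show m + 1 + k - k = m + 1 by omega]

end Quantile

/-! ### Recursions and geometric growth. -/

lemma tendsto_zero_of_contraction {w κ η : ℕ → ℝ} {κ₀ : ℝ} (hκ₀ : |κ₀| < 1)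
    (hκ : Tendsto κ atTop (𝓝 κ₀)) (hη : Tendsto η atTop (𝓝 0))
    (hw : ∀ᶠ j in atTop, w (j + 1) = κ j * w j + η j) : Tendsto w atTop (𝓝 0) := by
  obtain ⟨θ, hθ1, hθ2⟩ := exists_between hκ₀
  have hθ0 : 0 ≤ θ := (abs_nonneg _).trans hθ1.le
  rw [Metric.tendsto_atTop]
  intro ε hε
  have h1 : ∀ᶠ j in atTop, |κ j| < θ := hκ.abs.eventually (gt_mem_nhds hθ1)
  -- The factor 1 - θ makes ε / 2 a fixed point of r ↦ θ r + ε / 2 * (1 - θ).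
  have h2 : ∀ᶠ j in atTop, |η j| < ε / 2 * (1 - θ) := by
    have := hη.abs
    rw [abs_zero] at this
    exact this.eventually (gt_mem_nhds (mul_pos (half_pos hε) (by linarith)))
  obtain ⟨N, hN⟩ := eventually_atTop.1 (hw.and (h1.and h2))
  have h3 : ∀ i, |w (N + i)| ≤ θ ^ i * |w N| + ε / 2 := by
    intro i
    induction i with
    | zero => simp; linarith
    | succ i ih =>
      obtain ⟨ha, hb, hc⟩ := hN (N + i) (by omega)
      rw [← add_assoc, ha]
      calc |κ (N + i) * w (N + i) + η (N + i)|
          ≤ |κ (N + i)| * |w (N + i)| + |η (N + i)| := by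
            rw [← abs_mul]; exact abs_add_le _ _
        _ ≤ θ * (θ ^ i * |w N| + ε / 2) + ε / 2 * (1 - θ) :=
            add_le_add (mul_le_mul hb.le ih (abs_nonneg _) hθ0) hc.le
        _ = θ ^ (i + 1) * |w N| + ε / 2 := by ring
  have h4 : Tendsto (fun i => θ ^ i * |w N|) atTop (𝓝 0) := by
    simpa using (tendsto_pow_atTop_nhds_zero_of_lt_one hθ0 hθ2).mul_const |w N|
  obtain ⟨M, hM⟩ := eventually_atTop.1 (h4.eventually (gt_mem_nhds (half_pos hε)))
  refine ⟨N + M, fun j hj => ?_⟩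
  obtain ⟨i, rfl⟩ := Nat.exists_eq_add_of_le (show N ≤ j by omega)
  rw [Real.dist_eq, sub_zero]
  have := hM i (by omega)
  linarith [h3 i]

/-- A sequence whose increments grow geometrically grows geometrically at the same rate. -/
lemma tendsto_ratio_of_increments {u : ℕ → ℝ} {ρ : ℝ} (hρ : 1 < ρ)
    (hpos : ∀ᶠ j in atTop, 0 < u (j + 1) - u j)
    (h : Tendsto (fun j => (u (j + 2) - u (j + 1)) / (u (j + 1) - u j)) atTop (𝓝 ρ)) :
    (∀ᶠ j in atTop, 0 < u j) ∧ Tendsto (fun j => u (j + 1) / u j) atTop (𝓝 ρ) := by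
  have hρ0 : 0 < ρ - 1 := by linarith
  -- For an exactly geometric sequence of ratio ρ, the quotient of a term by its increment is c, the
  -- fixed point of s ↦ (s + 1) / ρ. The actual quotient satisfies a perturbed version of this
  -- recursion.
  set c : ℝ := 1 / (ρ - 1) with hc
  have hc0 : 0 < c := by positivity
  have hκ : Tendsto (fun j => (u (j + 1) - u j) / (u (j + 2) - u (j + 1))) atTop (𝓝 ρ⁻¹) := by
    simpa using h.inv₀ (by linarith)
  have hη : Tendsto (fun j => (u (j + 1) - u j) / (u (j + 2) - u (j + 1)) * (c + 1) - c) atTop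
      (𝓝 0) := by
    have := (hκ.mul_const (c + 1)).sub_const c
    have h0 : ρ⁻¹ * (c + 1) - c = 0 := by
      rw [hc]; field_simp; ring
    rwa [h0] at this
  have hpos' := (tendsto_add_atTop_nat 1).eventually hpos
  have hw := tendsto_zero_of_contraction (w := fun j => u j / (u (j + 1) - u j) - c)
    (by rw [abs_of_pos (by positivity)]; exact inv_lt_one_of_one_lt₀ hρ) hκ hη (by
      filter_upwards [hpos, hpos'] with j h1 h2
      have h2' : u (j + 2) - u (j + 1) ≠ 0 := h2.ne'
      have h1' := h1.ne'
      change u (j + 1) / (u (j + 2) - u (j + 1)) - c = _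
      field_simp
      ring)
  have hw' : Tendsto (fun j => u j / (u (j + 1) - u j)) atTop (𝓝 c) := by
    simpa using hw.add_const c
  refine ⟨?_, ?_⟩
  · filter_upwards [hpos, hw'.eventually (lt_mem_nhds hc0)] with j h1 h2
    exact (div_pos_iff_of_pos_right h1).1 h2
  · have h3 : Tendsto (fun j => 1 + (u j / (u (j + 1) - u j))⁻¹) atTop (𝓝 (1 + c⁻¹)) :=
      (hw'.inv₀ hc0.ne').const_add 1
    have h4 : 1 + c⁻¹ = ρ := by rw [hc]; simp
    rw [h4] at h3
    refine h3.congr' ?_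
    filter_upwards [hpos, hw'.eventually (lt_mem_nhds hc0)] with j h1 h2
    have := (div_pos_iff_of_pos_right h1).1 h2
    field_simp
    ring

/-! ### Regular variation of the quantile function and the Potter bound. -/

section Quantile

variable {μ : Measure ℝ} {γ : ℝ} {a b : ℕ → ℝ}

lemma frechetCDF_of_pos {x : ℝ} (hx : 0 < x) :
    frechetCDF γ x = Real.exp (-(x ^ (-1 / γ))) := if_pos hx

lemma frechetCDF_rpow (hγ : 0 < γ) {x : ℝ} (hx : 0 < x) :
    frechetCDF γ (x ^ γ) = Real.exp (-(1 / x)) := by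
  rw [frechetCDF_of_pos (Real.rpow_pos_of_pos hx _), ← Real.rpow_mul hx.le]
  have : γ * (-1 / γ) = -1 := by field_simp
  rw [this, Real.rpow_neg_one, one_div]

lemma frechetCDF_lt_of_lt (hγ : 0 < γ) {v w : ℝ} (hw : 0 < w) (h : v < w) :
    frechetCDF γ v < frechetCDF γ w := by
  rw [frechetCDF_of_pos hw]
  rcases lt_or_ge 0 v with hv | hv
  · rw [frechetCDF_of_pos hv, Real.exp_lt_exp, neg_lt_neg_iff]
    exact Real.rpow_lt_rpow_of_neg hv h (div_neg_of_neg_of_pos (by norm_num) hγ)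
  · rw [frechetCDF, if_neg hv.not_gt]
    exact Real.exp_pos _

/-- Convergence of normalized quantiles. -/
lemma tendsto_tailQuantile_normalized (hγ : 0 < γ) (ha : ∀ n, 0 < a n)
    (hF : ∀ x : ℝ, Tendsto (fun n : ℕ => cdf μ (a n * x + b n) ^ n) atTop (𝓝 (frechetCDF γ x)))
    {x : ℝ} (hx : 0 < x) :
    Tendsto (fun t : ℝ => (tailQuantile (cdf μ) (t * x) - b ⌊t⌋₊) / a ⌊t⌋₊) atTop
      (𝓝 (x ^ γ)) := by
  have hxγ : 0 < x ^ γ := Real.rpow_pos_of_pos hx _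
  have hfl : Tendsto (fun t : ℝ => ⌊t⌋₊) atTop atTop := tendsto_nat_floor_atTop
  have hbig : ∀ᶠ t : ℝ in atTop, 1 < t * x := by
    filter_upwards [eventually_gt_atTop (1 / x)] with t ht
    rwa [div_lt_iff₀ hx] at ht
  -- With n = ⌊t⌋, the level 1 - 1/(t x) lies between those with n and n + 1 in place of t; both
  -- n-th powers tend to exp (-1/x), the Fréchet value at x ^ γ.
  have hL1 : Tendsto (fun n : ℕ => (1 + -(1 / ((n + 1 : ℝ) * x))) ^ n) atTop
      (𝓝 (Real.exp (-(1 / x)))) := by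
    refine Real.tendsto_one_add_pow_exp_of_tendsto ?_
    have := (tendsto_natCast_div_add_atTop (1 : ℝ)).mul_const (-(1 / x))
    rw [one_mul] at this
    refine this.congr fun n => ?_
    have : (n + 1 : ℝ) ≠ 0 := by positivity
    field_simp
  have hL2 : Tendsto (fun n : ℕ => (1 + -(1 / ((n : ℝ) * x))) ^ n) atTop
      (𝓝 (Real.exp (-(1 / x)))) := by
    refine Real.tendsto_one_add_pow_exp_of_tendsto (tendsto_const_nhds.congr' ?_)
    filter_upwards [eventually_gt_atTop 0] with n hn
    have : (n : ℝ) ≠ 0 := by positivity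
    field_simp
  rw [tendsto_order]
  constructor
  · intro v hv
    have hlt := frechetCDF_lt_of_lt hγ hxγ hv
    rw [frechetCDF_rpow hγ hx] at hlt
    have h1 := hfl.eventually ((hF v).eventually_lt hL2 hlt)
    filter_upwards [h1, hbig, eventually_ge_atTop 1,
      hfl.eventually (eventually_ge_atTop ⌈1 / x⌉₊)] with t h1 h2 h3 h4
    have hn1 : (1 : ℝ) ≤ (⌊t⌋₊ : ℝ) := by exact_mod_cast Nat.le_floor (by simpa using h3)
    have hnt : (⌊t⌋₊ : ℝ) ≤ t := Nat.floor_le (by linarith)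
    have hnx : 1 ≤ (⌊t⌋₊ : ℝ) * x := by
      rw [← div_le_iff₀ hx]
      exact Nat.ceil_le.1 h4
    have h5 := lt_of_pow_lt_pow_left₀ _ (by
      have : 1 / ((⌊t⌋₊ : ℝ) * x) ≤ 1 := (div_le_one (by linarith)).2 hnx
      linarith) h1
    rw [lt_div_iff₀ (ha _), lt_sub_iff_add_lt]
    by_contra hcon
    rw [not_lt, tailQuantile_le_iff h2] at hcon
    have h6 : 1 / (t * x) ≤ 1 / ((⌊t⌋₊ : ℝ) * x) := by
      apply one_div_le_one_div_of_le (by linarith)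
      exact mul_le_mul_of_nonneg_right hnt hx.le
    rw [mul_comm v] at hcon
    linarith
  · intro v hv
    -- The quantile criterion gives only a weak inequality; room is left for a strict one.
    obtain ⟨v', hv1, hv2⟩ := exists_between hv
    have hlt := frechetCDF_lt_of_lt hγ (hxγ.trans hv1) hv1
    rw [frechetCDF_rpow hγ hx] at hlt
    have h1 := hfl.eventually (hL1.eventually_lt (hF v') hlt)
    filter_upwards [h1, hbig, eventually_ge_atTop 1] with t h1 h2 h3
    have h5 := lt_of_pow_lt_pow_left₀ _ (cdf_nonneg μ _) h1
    have h6 : 1 / (((⌊t⌋₊ : ℝ) + 1) * x) ≤ 1 / (t * x) := by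
      apply one_div_le_one_div_of_le (by linarith)
      exact mul_le_mul_of_nonneg_right (Nat.lt_floor_add_one t).le hx.le
    have h7 : tailQuantile (cdf μ) (t * x) ≤ a ⌊t⌋₊ * v' + b ⌊t⌋₊ := by
      rw [tailQuantile_le_iff h2]
      linarith
    rw [div_lt_iff₀ (ha _)]
    have := mul_lt_mul_of_pos_left hv2 (ha ⌊t⌋₊)
    linarith

/-- Three consecutive lattice points share the same norming pair: differences eliminate b and their
quotient eliminates a. Geometric growth of the increments then passes to the quantiles themselves.
-/
lemma tendsto_expQuantile_ratio (hγ : 0 < γ) (hF : InFrechetDoA (cdf μ) γ) {δ : ℝ} (hδ : 0 < δ) :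
    (∀ᶠ j : ℕ in atTop, 0 < expQuantile μ (j * δ)) ∧
      Tendsto (fun j : ℕ => expQuantile μ ((j + 1 : ℕ) * δ) / expQuantile μ (j * δ)) atTop
        (𝓝 (Real.exp (γ * δ))) := by
  obtain ⟨a, b, ha, hF⟩ := hF
  have hr : Tendsto (fun j : ℕ => Real.exp (j * δ)) atTop atTop :=
    Real.tendsto_exp_atTop.comp (tendsto_natCast_atTop_atTop.atTop_mul_const hδ)
  have hs : ∀ i : ℕ, Tendsto (fun j : ℕ => (expQuantile μ ((j + i : ℕ) * δ) -
      b ⌊Real.exp (j * δ)⌋₊) / a ⌊Real.exp (j * δ)⌋₊) atTop (𝓝 (Real.exp (γ * δ) ^ i)) := by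
    intro i
    have h := (tendsto_tailQuantile_normalized hγ ha hF (Real.exp_pos (i * δ))).comp hr
    rw [← Real.exp_mul, show (i : ℝ) * δ * γ = i * (γ * δ) by ring] at h
    rw [← Real.exp_nat_mul]
    refine h.congr fun j => ?_
    simp only [Function.comp_apply]
    rw [← Real.exp_add, expQuantile]
    push_cast
    rw [add_mul]
  have hρ : 1 < Real.exp (γ * δ) := Real.one_lt_exp_iff.2 (by positivity)
  set ρ := Real.exp (γ * δ)
  refine tendsto_ratio_of_increments hρ ?_ ?_
  · have h := (hs 1).sub (hs 0)
    filter_upwards [h.eventually (lt_mem_nhds (show 0 < ρ ^ 1 - ρ ^ 0 by simpa using hρ))]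
      with j hj
    rw [← sub_div, div_pos_iff_of_pos_right (ha _)] at hj
    simpa using hj
  · have h := ((hs 2).sub (hs 1)).div ((hs 1).sub (hs 0))
      (by simpa using (sub_pos.2 hρ).ne')
    have h0 : (ρ ^ 2 - ρ ^ 1) / (ρ ^ 1 - ρ ^ 0) = ρ := by
      have : ρ - 1 ≠ 0 := (sub_pos.2 hρ).ne'
      rw [pow_one, pow_zero]
      field_simp
    rw [h0] at h
    refine h.congr fun j => ?_
    simp only [Pi.div_apply]
    rw [← sub_div, ← sub_div, div_div_div_cancel_right₀ (ha _).ne']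
    simp

/-- A Potter type bound for the quantile function of a law in the Fréchet domain. -/
theorem exists_potter_bound (hγ : 0 < γ) (hF : InFrechetDoA (cdf μ) γ) {ε : ℝ} (hε : 0 < ε) :
    ∃ t₀ : ℝ, 0 < t₀ ∧ ∀ t, t₀ ≤ t → 0 < expQuantile μ t ∧ ∀ z, 0 ≤ z →
      |Real.log (expQuantile μ (t + z) / expQuantile μ t) - γ * z| ≤ ε * (1 + z) := by
  -- Rounding to the lattice changes the length by at most 2 δ at slope at most γ + η ≤ 2 γ, a cost
  -- of 4 γ δ = ε. The bound η ≤ ε controls the error in the slope, and η ≤ γ keeps γ - η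
  -- nonnegative.
  set δ : ℝ := ε / (4 * γ) with hδdef
  have hδ : 0 < δ := by positivity
  have hδε : 4 * γ * δ = ε := by rw [hδdef]; field_simp
  set η : ℝ := min ε γ with hηdef
  have hη : 0 < η := lt_min hε hγ
  have hηε : η ≤ ε := min_le_left _ _
  have hηγ : η ≤ γ := min_le_right _ _
  obtain ⟨hpos, hrat⟩ := tendsto_expQuantile_ratio hγ hF hδ
  have hlog := hrat.log (Real.exp_pos _).ne'
  rw [Real.log_exp] at hlog
  have hcl := (Metric.tendsto_nhds.1 hlog) (η * δ) (by positivity)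
  obtain ⟨J, hJ⟩ := eventually_atTop.1 (hpos.and hcl)
  set q : ℝ → ℝ := fun x => Real.log (expQuantile μ x) with hq
  have hstep : ∀ j, J ≤ j → ∀ i : ℕ,
      |q ((j + i : ℕ) * δ) - q (j * δ) - i * (γ * δ)| ≤ i * (η * δ) := by
    intro j hj i
    induction i with
    | zero => simp
    | succ i ih =>
      have h1 := (hJ (j + i) (by omega)).2
      rw [Real.dist_eq, Real.log_div (hJ (j + i + 1) (by omega)).1.ne'
        (hJ (j + i) (by omega)).1.ne'] at h1
      rw [abs_le] at ih
      rw [abs_lt] at h1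
      rw [← add_assoc, abs_le]
      push_cast at *
      constructor <;> linarith [ih.1, ih.2, h1.1, h1.2]
  -- J may be 0, while monotonicity of the quantile needs a positive argument; hence J + 1.
  have hQpos : ∀ t : ℝ, ((J + 1 : ℕ) : ℝ) * δ ≤ t → 0 < expQuantile μ t := fun t ht =>
    (hJ (J + 1) (by omega)).1.trans_le (expQuantile_mono (by positivity) ht)
  have hqmono : ∀ s t : ℝ, ((J + 1 : ℕ) : ℝ) * δ ≤ s → s ≤ t → q s ≤ q t := fun s t hs hst =>
    Real.log_le_log (hQpos s hs) (expQuantile_mono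
      ((by positivity : 0 < ((J + 1 : ℕ) : ℝ) * δ).trans_le hs) hst)
  refine ⟨((J + 1 : ℕ) : ℝ) * δ, by positivity, fun t ht => ⟨hQpos t ht, fun z hz => ?_⟩⟩
  rw [Real.log_div (hQpos _ (by linarith)).ne' (hQpos t ht).ne']
  have ht0 : 0 ≤ t := le_trans (by positivity) ht
  have hj1 : (⌊t / δ⌋₊ : ℝ) * δ ≤ t := by
    rw [← le_div_iff₀ hδ]; exact Nat.floor_le (by positivity)
  have hj2 : t < ((⌊t / δ⌋₊ : ℝ) + 1) * δ := by
    rw [← div_lt_iff₀ hδ]; exact Nat.lt_floor_add_one _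
  have hl1 : (⌊(t + z) / δ⌋₊ : ℝ) * δ ≤ t + z := by
    rw [← le_div_iff₀ hδ]; exact Nat.floor_le (by positivity)
  have hl2 : t + z < ((⌊(t + z) / δ⌋₊ : ℝ) + 1) * δ := by
    rw [← div_lt_iff₀ hδ]; exact Nat.lt_floor_add_one _
  have hJj : J + 1 ≤ ⌊t / δ⌋₊ := Nat.le_floor (by rwa [le_div_iff₀ hδ])
  have hjl : ⌊t / δ⌋₊ ≤ ⌊(t + z) / δ⌋₊ := Nat.floor_le_floor (by gcongr; linarith)
  set j := ⌊t / δ⌋₊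
  set l := ⌊(t + z) / δ⌋₊
  have hJjδ : ((J + 1 : ℕ) : ℝ) * δ ≤ j * δ := by
    have : ((J + 1 : ℕ) : ℝ) ≤ j := by exact_mod_cast hJj
    gcongr
  change |q (t + z) - q t - γ * z| ≤ _
  rw [abs_le]
  constructor
  -- The lower bound uses lattice points inside [t, t + z]; if both ends lie in one cell,
  -- monotonicity suffices. The upper bound uses the enclosing lattice points.
  · rcases hjl.eq_or_lt with h | h
    · have h1 := hqmono t (t + z) ht (by linarith)
      rw [← h] at hl2
      have : γ * z ≤ γ * δ := by
        apply mul_le_mul_of_nonneg_left _ hγ.le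
        linarith
      have : 0 ≤ ε * z := by positivity
      linarith
    · obtain ⟨i, hi⟩ := Nat.exists_eq_add_of_le (Nat.succ_le_of_lt h)
      have h1 := hstep (j + 1) (by omega) i
      rw [← Nat.succ_eq_add_one, ← hi, abs_le, Nat.succ_eq_add_one] at h1
      have h2 : q t ≤ q ((j + 1 : ℕ) * δ) := hqmono _ _ ht (by push_cast; linarith)
      have hlc : (l : ℝ) = j + 1 + i := by rw [hi]; push_cast; ring
      have h3 : q (l * δ) ≤ q (t + z) := by
        refine hqmono _ _ (hJjδ.trans ?_) hl1
        have : (j : ℝ) ≤ l := by exact_mod_cast hjl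
        gcongr
      have h4 : z - 2 * δ ≤ i * δ := by
        rw [hlc] at hl2
        linarith
      have h5 : (γ - η) * (z - 2 * δ) ≤ (γ - η) * (i * δ) :=
        mul_le_mul_of_nonneg_left h4 (by linarith)
      have h6 : η * z ≤ ε * z := by gcongr
      have h7 : 0 ≤ η * δ := by positivity
      have h8 : 0 ≤ γ * δ := by positivity
      linarith [h1.1]
  · obtain ⟨i, hi⟩ := Nat.exists_eq_add_of_le hjl
    have h1 := hstep j (by omega) (i + 1)
    rw [← add_assoc, ← hi, abs_le] at h1
    have h2 : q (j * δ) ≤ q t := hqmono _ _ hJjδ hj1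
    have h3 : q (t + z) ≤ q ((l + 1 : ℕ) * δ) :=
      hqmono _ _ (by linarith) (by push_cast; linarith)
    have hlc : (l : ℝ) = j + i := by rw [hi]; push_cast; ring
    have h4 : (i + 1 : ℝ) * δ ≤ z + 2 * δ := by
      rw [hlc] at hl1
      linarith
    have h5 : (γ + η) * ((i + 1 : ℝ) * δ) ≤ (γ + η) * (z + 2 * δ) :=
      mul_le_mul_of_nonneg_left h4 (by linarith)
    have h6 : η * z ≤ ε * z := by gcongr
    have h7 : η * δ ≤ γ * δ := by gcongr
    push_cast at h1
    push_cast at h3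
    linarith [h1.2]

end Quantile

/-! ### Exponential sequences and their sums. -/

/-- The law of a sequence of independent standard exponential variables. -/
noncomputable abbrev expSeq : Measure (ℕ → ℝ) := Measure.infinitePi fun _ => stdExp

lemma hasLaw_expSeq_eval (i : ℕ) : HasLaw (fun z : ℕ → ℝ => z i) stdExp expSeq :=
  ⟨(measurable_pi_apply i).aemeasurable, Measure.infinitePi_map_eval _ i⟩

lemma iIndepFun_expSeq : iIndepFun (fun i (z : ℕ → ℝ) => z i) expSeq :=
  iIndepFun_infinitePi (X := fun _ x => x) fun _ => measurable_id

lemma map_expSeq_fin (n : ℕ) :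
    expSeq.map (fun z (i : Fin n) => z i) = Measure.pi fun _ => stdExp := by
  rw [← Measure.infinitePi_eq_pi]
  exact Measure.map_infinitePi_infinitePi_of_inj (P := fun _ => stdExp) Fin.val_injective

lemma ae_expSeq_pos : ∀ᵐ z ∂expSeq, ∀ i, 0 < z i := by
  rw [ae_all_iff]
  exact fun i => (measurePreserving_eval_infinitePi (fun _ => stdExp) i).quasiMeasurePreserving.ae
    ae_stdExp_pos

lemma ae_expSeq_lln {f : ℝ → ℝ} (hf : Measurable f) (hint : Integrable f stdExp) :
    ∀ᵐ z ∂expSeq, Tendsto (fun n : ℕ => (∑ i ∈ Finset.range n, f (z i)) / n) atTop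
      (𝓝 (∫ x, f x ∂stdExp)) := by
  have hlaw := hasLaw_expSeq_eval
  have h := strong_law_ae_real (μ := expSeq) (fun i z => f (z i))
    ((measurePreserving_eval_infinitePi (fun _ => stdExp) 0).integrable_comp_of_integrable hint)
    (fun i j hij => (iIndepFun_expSeq.indepFun hij).comp hf hf)
    (fun i => (IdentDistrib.mk (hlaw i).aemeasurable (hlaw 0).aemeasurable
      ((hlaw i).map_eq.trans (hlaw 0).map_eq.symm)).comp hf)
  have he : ∫ z, f (z 0) ∂expSeq = ∫ x, f x ∂stdExp :=
    (hlaw 0).integral_comp hint.aestronglyMeasurable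
  rwa [he] at h

lemma hasLaw_sum_expSeq (k : ℕ) :
    HasLaw (fun z : ℕ → ℝ => ∑ i ∈ Finset.range (k + 1), z i) (gammaMeasure ((k + 1 : ℕ) : ℝ) 1)
      expSeq := by
  induction k with
  | zero => simpa [stdExp, expMeasure] using hasLaw_expSeq_eval 0
  | succ k ih =>
    have hind : IndepFun (fun z : ℕ → ℝ => ∑ i ∈ Finset.range (k + 1), z i) (fun z => z (k + 1))
        expSeq := by
      have := iIndepFun_expSeq.indepFun_finsetSum_of_notMem₀
        (fun i => (measurable_pi_apply i).aemeasurable)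
        (s := Finset.range (k + 1)) (i := k + 1) (by simp)
      convert! this using 1
      ext z
      simp
    have := isProbabilityMeasure_gammaMeasure (a := ((k + 1 : ℕ) : ℝ)) (by positivity) one_pos
    have h := hind.hasLaw_fun_add ih (hasLaw_expSeq_eval (k + 1))
    rw [gammaMeasure_conv_stdExp (by positivity)] at h
    simp_rw [Finset.sum_range_succ _ (k + 1)]
    exact_mod_cast h

lemma hasLaw_scaled_sum_expSeq {γ : ℝ} (hγ : 0 < γ) {k : ℕ} (hk : 1 ≤ k) :
    HasLaw (fun z : ℕ → ℝ => γ / k * ∑ i ∈ Finset.range k, z i) (gammaMeasure (k : ℝ) (k / γ))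
      expSeq := by
  obtain ⟨k, rfl⟩ : ∃ l, k = l + 1 := ⟨k - 1, by omega⟩
  have hc : 0 < γ / ((k + 1 : ℕ) : ℝ) := by positivity
  have h : HasLaw (fun x : ℝ => γ / ((k + 1 : ℕ) : ℝ) * x)
      (gammaMeasure ((k + 1 : ℕ) : ℝ) (((k + 1 : ℕ) : ℝ) / γ)) (gammaMeasure ((k + 1 : ℕ) : ℝ) 1) :=
    ⟨(measurable_const_mul _).aemeasurable, by rw [map_mul_gammaMeasure hc, one_div_div]⟩
  exact h.fun_comp (hasLaw_sum_expSeq k)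

/-! ### Almost sure behaviour of the threshold. -/

section OrderStat

/-- The `(n - k)`-th smallest of the first `n` terms of a sequence. -/
noncomputable def seqOrderStat (e : ℕ → ℝ) (n k : ℕ) : ℝ := orderStat (fun i : Fin n => e i) (n - k)

lemma measurable_seqOrderStat (n k : ℕ) : Measurable fun e : ℕ → ℝ => seqOrderStat e n k :=
  (measurable_orderStat (n - k)).comp (measurable_pi_lambda _ fun _ => measurable_pi_apply _)

lemma lt_seqOrderStat_iff (e : ℕ → ℝ) {n k : ℕ} (hkn : k < n) (t : ℝ) :
    t < seqOrderStat e n k ↔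
      (k : ℝ) < ∑ i ∈ Finset.range n, (Set.Ioi t).indicator (fun _ => (1 : ℝ)) (e i) := by
  have h1 : ∑ i ∈ Finset.range n, (Set.Ioi t).indicator (fun _ => (1 : ℝ)) (e i) =
      ((Finset.univ.filter fun i : Fin n => ¬ e i ≤ t).card : ℝ) := by
    rw [Finset.sum_range, Finset.card_filter]
    push_cast
    refine Finset.sum_congr rfl fun i _ => ?_
    simp [Set.indicator_apply]
  have h2 := Finset.card_filter_add_card_filter_not (s := (Finset.univ : Finset (Fin n)))
    (fun i : Fin n => e i ≤ t)
  rw [Finset.card_univ, Fintype.card_fin] at h2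
  rw [h1, Nat.cast_lt, ← not_le, seqOrderStat, orderStat_le_iff _ (by omega) (by omega)]
  omega

/-- A sequence with the empirical tail behaviour of exponential variables. -/
def IsExpTypical (e : ℕ → ℝ) : Prop :=
  (∀ i, 0 < e i) ∧ ∀ q : ℚ, 0 ≤ q → Tendsto (fun n : ℕ =>
    (∑ i ∈ Finset.range n, (Set.Ioi (q : ℝ)).indicator (fun _ => (1 : ℝ)) (e i)) / n) atTop
      (𝓝 (Real.exp (-q)))

/-- Restricting to rational levels leaves countably many laws of large numbers, hence one null set
valid for every sequence k. -/
lemma ae_isExpTypical : ∀ᵐ e ∂expSeq, IsExpTypical e := by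
  refine ae_expSeq_pos.and (ae_all_iff.2 fun q => ?_)
  by_cases hq : 0 ≤ q
  · have h := ae_expSeq_lln (f := (Set.Ioi (q : ℝ)).indicator fun _ => (1 : ℝ))
      (measurable_const.indicator measurableSet_Ioi)
      ((integrable_const 1).indicator measurableSet_Ioi)
    rw [integral_indicator_const _ measurableSet_Ioi, measureReal_def,
      stdExp_Ioi (by exact_mod_cast hq), ENNReal.toReal_ofReal (Real.exp_nonneg _), smul_eq_mul,
      mul_one] at h
    filter_upwards [h] with e he _ using he
  · exact ae_of_all _ fun e h => absurd h hq

lemma seqOrderStat_pos {e : ℕ → ℝ} (he : ∀ i, 0 < e i) {n k : ℕ} (hkn : k < n) :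
    0 < seqOrderStat e n k := by
  rw [lt_seqOrderStat_iff e hkn]
  simp [Set.indicator, he, hkn]

lemma eventually_lt_seqOrderStat {e : ℕ → ℝ} (he : IsExpTypical e) {k : ℕ → ℕ}
    (hk : ∀ᶠ n in atTop, 1 ≤ k n ∧ k n < n) {c : ℝ}
    (hkc : Tendsto (fun n : ℕ => (k n : ℝ) / (n : ℝ)) atTop (𝓝 c)) {q : ℚ} (hq : 0 ≤ q) (hc : c < Real.exp (-q)) :
    ∀ᶠ n in atTop, (q : ℝ) < seqOrderStat e n (k n) := by
  filter_upwards [hk, hkc.eventually_lt (he.2 q hq) hc] with n h1 h2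
  rw [lt_seqOrderStat_iff e h1.2]
  have : (0 : ℝ) < n := by exact_mod_cast (show 0 < n by omega)
  exact (div_lt_div_iff_of_pos_right this).1 h2

lemma eventually_seqOrderStat_le {e : ℕ → ℝ} (he : IsExpTypical e) {k : ℕ → ℕ}
    (hk : ∀ᶠ n in atTop, 1 ≤ k n ∧ k n < n) {c : ℝ}
    (hkc : Tendsto (fun n : ℕ => (k n : ℝ) / (n : ℝ)) atTop (𝓝 c)) {q : ℚ} (hq : 0 ≤ q) (hc : Real.exp (-q) < c) :
    ∀ᶠ n in atTop, seqOrderStat e n (k n) ≤ q := by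
  filter_upwards [hk, (he.2 q hq).eventually_lt hkc hc] with n h1 h2
  rw [← not_lt, lt_seqOrderStat_iff e h1.2, not_lt]
  have : (0 : ℝ) < n := by exact_mod_cast (show 0 < n by omega)
  exact ((div_lt_div_iff_of_pos_right this).1 h2).le

lemma tendsto_seqOrderStat_atTop {e : ℕ → ℝ} (he : IsExpTypical e) {k : ℕ → ℕ}
    (hk : ∀ᶠ n in atTop, 1 ≤ k n ∧ k n < n)
    (hk0 : Tendsto (fun n : ℕ => (k n : ℝ) / (n : ℝ)) atTop (𝓝 0)) :
    Tendsto (fun n => seqOrderStat e n (k n)) atTop atTop := by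
  refine tendsto_atTop.2 fun B => ?_
  obtain ⟨N, hN⟩ := exists_nat_ge B
  filter_upwards [eventually_lt_seqOrderStat he hk hk0 (q := (N : ℚ)) (Nat.cast_nonneg N)
    (Real.exp_pos _)] with n hn
  rw [Rat.cast_natCast] at hn
  exact hN.trans hn.le

lemma tendsto_seqOrderStat {e : ℕ → ℝ} (he : IsExpTypical e) {k : ℕ → ℕ}
    (hk : ∀ᶠ n in atTop, 1 ≤ k n ∧ k n < n) {c : ℝ}
    (hkc : Tendsto (fun n : ℕ => (k n : ℝ) / (n : ℝ)) atTop (𝓝 c)) (hc0 : 0 < c) :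
    Tendsto (fun n => seqOrderStat e n (k n)) atTop (𝓝 (-Real.log c)) := by
  rw [tendsto_order]
  constructor
  · intro v hv
    rcases lt_or_ge v 0 with h0 | h0
    · filter_upwards [hk] with n hn
      exact h0.trans (seqOrderStat_pos he.1 hn.2)
    · obtain ⟨q, hq1, hq2⟩ := exists_rat_btwn hv
      filter_upwards [eventually_lt_seqOrderStat he hk hkc (q := q)
        (by exact_mod_cast h0.trans hq1.le)
        (by rw [← Real.log_lt_iff_lt_exp hc0]; linarith)] with n hn
      exact hq1.trans hn
  · intro v hv
    -- This makes -log c nonnegative, so the rational level chosen above it is nonnegative too.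
    have hc1 : c ≤ 1 := by
      refine le_of_tendsto hkc ?_
      filter_upwards [hk] with n hn
      have : (0 : ℝ) < n := by exact_mod_cast (show 0 < n by omega)
      rw [div_le_one this]
      exact_mod_cast hn.2.le
    have := Real.log_nonpos hc0.le hc1
    obtain ⟨q, hq1, hq2⟩ := exists_rat_btwn hv
    filter_upwards [eventually_seqOrderStat_le he hk hkc (q := q)
      (by exact_mod_cast (show (0 : ℝ) ≤ q by linarith))
      (by rw [← Real.lt_log_iff_exp_lt hc0]; linarith)] with n hn
    exact hn.trans_lt hq2

end OrderStat

/-! ### Limits of the remainder. -/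

section Remainder

variable {μ : Measure ℝ} {γ : ℝ}

/-- The Hill statistic of the quantile transform of a threshold `t` and `k` excesses over it. -/
noncomputable def hillOfExcesses (μ : Measure ℝ) (t : ℝ) (z : ℕ → ℝ) (k : ℕ) : ℝ :=
  ∑ i ∈ Finset.range k, (1 / (k : ℝ)) * Real.log (expQuantile μ (t + z i) / expQuantile μ t)

lemma measurable_hillOfExcesses (k : ℕ) :
    Measurable fun p : ℝ × (ℕ → ℝ) => hillOfExcesses μ p.1 p.2 k := by
  refine Finset.measurable_sum _ fun i _ => Measurable.const_mul (Real.measurable_log.comp ?_) _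
  exact (measurable_expQuantile.comp (measurable_fst.add
    ((measurable_pi_apply i).comp measurable_snd))).div (measurable_expQuantile.comp measurable_fst)

/-- The difference between the Hill statistic and its gamma distributed main part. -/
noncomputable def hillRemainder (μ : Measure ℝ) (γ t : ℝ) (z : ℕ → ℝ) (k : ℕ) : ℝ :=
  hillOfExcesses μ t z k - γ / k * ∑ i ∈ Finset.range k, z i

lemma abs_hillRemainder_le {t ε : ℝ} (hε : 0 ≤ ε)
    (h : ∀ z, 0 ≤ z →
      |Real.log (expQuantile μ (t + z) / expQuantile μ t) - γ * z| ≤ ε * (1 + z))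
    {z : ℕ → ℝ} (hz : ∀ i, 0 < z i) (k : ℕ) :
    |hillRemainder μ γ t z k| ≤ ε * (1 + (∑ i ∈ Finset.range k, z i) / k) := by
  rcases k.eq_zero_or_pos with rfl | hk
  · simpa [hillRemainder, hillOfExcesses] using hε
  have hk0 : (0 : ℝ) < k := by exact_mod_cast hk
  have h1 : hillRemainder μ γ t z k = ∑ i ∈ Finset.range k, (1 / (k : ℝ)) *
      (Real.log (expQuantile μ (t + z i) / expQuantile μ t) - γ * z i) := by
    simp_rw [mul_sub, Finset.sum_sub_distrib, hillRemainder, hillOfExcesses, ← Finset.mul_sum]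
    ring
  rw [h1]
  calc _ ≤ ∑ i ∈ Finset.range k, (1 / (k : ℝ)) * (ε * (1 + z i)) := by
        refine (Finset.abs_sum_le_sum_abs _ _).trans (Finset.sum_le_sum fun i _ => ?_)
        rw [abs_mul, abs_of_pos (by positivity)]
        exact mul_le_mul_of_nonneg_left (h _ (hz i).le) (by positivity)
    _ = _ := by
        rw [← Finset.mul_sum, ← Finset.mul_sum, Finset.sum_add_distrib, Finset.sum_const,
          Finset.card_range, nsmul_eq_mul]
        field_simp

/-- The Potter bound is averaged; convergence of the means of z serves only to bound them over all
sample sizes, so k is arbitrary. -/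
lemma tendsto_hillRemainder_zero (hγ : 0 < γ) (hF : InFrechetDoA (cdf μ) γ) {t : ℕ → ℝ}
    (ht : Tendsto t atTop atTop) {z : ℕ → ℝ} (hz : ∀ i, 0 < z i) {M : ℝ}
    (hM : Tendsto (fun n : ℕ => (∑ i ∈ Finset.range n, z i) / n) atTop (𝓝 M)) (k : ℕ → ℕ) :
    Tendsto (fun n => hillRemainder μ γ (t n) z (k n)) atTop (𝓝 0) := by
  obtain ⟨C, hC⟩ := hM.bddAbove_range
  have hC' : ∀ n : ℕ, (∑ i ∈ Finset.range n, z i) / n ≤ C := fun n => hC ⟨n, rfl⟩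
  have hC0 : 0 ≤ C := by simpa using hC' 0
  rw [Metric.tendsto_nhds]
  intro ε hε
  have hδ : 0 < ε / (2 * (1 + C)) := by positivity
  obtain ⟨t₀, -, h⟩ := exists_potter_bound hγ hF hδ
  filter_upwards [ht.eventually_ge_atTop t₀] with n hn
  rw [Real.dist_eq, sub_zero]
  refine (abs_hillRemainder_le hδ.le (h _ hn).2 hz _).trans_lt ?_
  calc ε / (2 * (1 + C)) * (1 + (∑ i ∈ Finset.range (k n), z i) / (k n))
      ≤ ε / (2 * (1 + C)) * (1 + C) := by gcongr; exact hC' _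
    _ = ε / 2 := by field_simp
    _ < ε := half_lt_self hε

/-- The logarithm of the quantile function, truncated below at level `v`. -/
noncomputable def truncLogQuantile (μ : Measure ℝ) (v x : ℝ) : ℝ :=
  if 0 < x then Real.log (max (expQuantile μ x) v) else Real.log v

variable {v : ℝ}

lemma log_le_truncLogQuantile (hv : 0 < v) (x : ℝ) : Real.log v ≤ truncLogQuantile μ v x := by
  unfold truncLogQuantile
  split_ifs
  · exact Real.log_le_log hv (le_max_right _ _)
  · rfl

/-- The quantile may be negative, where `Real.log` is not monotone, and it is 0 by default at
nonpositive arguments. Truncation cures both, so that shifts can be sandwiched and discontinuities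
are countable. -/
lemma truncLogQuantile_mono (hv : 0 < v) : Monotone (truncLogQuantile μ v) := by
  intro x y hxy
  by_cases hx : 0 < x
  · rw [truncLogQuantile, truncLogQuantile, if_pos hx, if_pos (hx.trans_le hxy)]
    exact Real.log_le_log (lt_max_of_lt_right hv) (max_le_max_right _ (expQuantile_mono hx hxy))
  · rw [truncLogQuantile, if_neg hx]
    exact log_le_truncLogQuantile hv y

lemma exists_truncLogQuantile_le (hγ : 0 < γ) (hF : InFrechetDoA (cdf μ) γ) (hv : 0 < v) :
    ∃ A : ℝ, ∀ x, 0 ≤ x → |truncLogQuantile μ v x| ≤ A + (γ + 1) * x := by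
  obtain ⟨t₀, ht₀, h⟩ := exists_potter_bound hγ hF one_pos
  obtain ⟨hQ, h⟩ := h t₀ le_rfl
  refine ⟨1 + |Real.log (expQuantile μ t₀)| + |Real.log v|, fun x hx => ?_⟩
  have hγx : 0 ≤ (γ + 1) * x := by positivity
  have hQx := hQ.trans_le (expQuantile_mono ht₀ (by linarith : t₀ ≤ t₀ + x))
  have h1 := (abs_le.1 (h x hx)).2
  rw [Real.log_div hQx.ne' hQ.ne'] at h1
  have a1 := abs_nonneg (Real.log (expQuantile μ t₀))
  have a2 := abs_nonneg (Real.log v)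
  have a3 := le_abs_self (Real.log (expQuantile μ t₀))
  have a4 := le_abs_self (Real.log v)
  have a5 := neg_abs_le (Real.log v)
  rw [abs_le]
  constructor
  · linarith [log_le_truncLogQuantile (μ := μ) hv x]
  · refine (truncLogQuantile_mono hv (by linarith : x ≤ t₀ + x)).trans ?_
    rw [truncLogQuantile, if_pos (by linarith)]
    rcases max_choice (expQuantile μ (t₀ + x)) v with hm | hm <;> rw [hm] <;> linarith

lemma abs_truncLogQuantile_add_le (hv : 0 < v) {A : ℝ}
    (hA : ∀ x, 0 ≤ x → |truncLogQuantile μ v x| ≤ A + (γ + 1) * x) {s t z : ℝ} (hts : |t| ≤ s)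
    (hz : 0 ≤ z) :
    |truncLogQuantile μ v (t + z)| ≤ A + |Real.log v| + (γ + 1) * (s + z) := by
  have hs : 0 ≤ s := (abs_nonneg _).trans hts
  have h1 := hA (s + z) (by linarith)
  have h2 := truncLogQuantile_mono (μ := μ) hv
    (by linarith [le_abs_self t] : t + z ≤ s + z)
  have h3 := log_le_truncLogQuantile (μ := μ) hv (t + z)
  have h4 := neg_abs_le (Real.log v)
  have h5 := abs_nonneg (truncLogQuantile μ v (s + z))
  have h6 := le_abs_self (truncLogQuantile μ v (s + z))
  have h7 := abs_nonneg (Real.log v)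
  rw [abs_le]
  constructor <;> linarith

lemma integrable_bound_stdExp (A B s : ℝ) : Integrable (fun z : ℝ => A + B * (s + z)) stdExp :=
  (integrable_const A).add (((integrable_const s).add integrable_id_stdExp).const_mul B)

lemma measurable_truncLogQuantile_add (hv : 0 < v) (t : ℝ) :
    Measurable fun z => truncLogQuantile μ v (t + z) :=
  (truncLogQuantile_mono hv).measurable.comp (measurable_const_add t)

lemma integrable_truncLogQuantile (hγ : 0 < γ) (hF : InFrechetDoA (cdf μ) γ) (hv : 0 < v)
    (t : ℝ) : Integrable (fun z => truncLogQuantile μ v (t + z)) stdExp := by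
  obtain ⟨A, hA⟩ := exists_truncLogQuantile_le hγ hF hv
  refine (integrable_bound_stdExp (A + |Real.log v|) (γ + 1) |t|).mono'
    (measurable_truncLogQuantile_add hv t).aestronglyMeasurable ?_
  filter_upwards [ae_stdExp_pos] with z hz
  exact abs_truncLogQuantile_add_le hv hA le_rfl hz.le

/-- The integrand is discontinuous at countably many points only, which the atomless exponential law
ignores; the linear growth bound from Potter dominates. -/
lemma continuous_integral_truncLogQuantile (hγ : 0 < γ) (hF : InFrechetDoA (cdf μ) γ)
    (hv : 0 < v) : Continuous fun t => ∫ z, truncLogQuantile μ v (t + z) ∂stdExp := by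
  obtain ⟨A, hA⟩ := exists_truncLogQuantile_le hγ hF hv
  refine continuous_iff_continuousAt.2 fun t₀ => ?_
  refine continuousAt_of_dominated
    (bound := fun z => A + |Real.log v| + (γ + 1) * (|t₀| + 1 + z)) ?_ ?_
    (integrable_bound_stdExp _ _ _) ?_
  · exact Eventually.of_forall fun t =>
      (measurable_truncLogQuantile_add hv t).aestronglyMeasurable
  · filter_upwards [Metric.ball_mem_nhds t₀ one_pos] with t ht
    filter_upwards [ae_stdExp_pos] with z hz
    refine abs_truncLogQuantile_add_le hv hA ?_ hz.le
    rw [Metric.mem_ball, Real.dist_eq] at ht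
    linarith [abs_sub_abs_le_abs_sub t t₀]
  · have hc : ({x | ¬ContinuousAt (truncLogQuantile μ v) x} : Set ℝ).Countable :=
      (truncLogQuantile_mono hv).countable_not_continuousAt
    have hc' : ((fun z => t₀ + z) ⁻¹' {x | ¬ContinuousAt (truncLogQuantile μ v) x}).Countable :=
      hc.preimage (add_right_injective t₀)
    have h0 : ∀ᵐ z ∂stdExp, z ∉ ((fun z => t₀ + z) ⁻¹'
        {x | ¬ContinuousAt (truncLogQuantile μ v) x}) := hc'.ae_notMem stdExp
    filter_upwards [h0] with z hz
    have h1 : ContinuousAt (truncLogQuantile μ v) (t₀ + z) := not_not.1 hz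
    exact h1.comp (f := fun t => t + z) (by fun_prop)

/-- Averages of `truncLogQuantile` over shifted samples converge along convergent shifts. -/
lemma tendsto_average_truncLogQuantile (hγ : 0 < γ) (hF : InFrechetDoA (cdf μ) γ) (hv : 0 < v)
    {z : ℕ → ℝ} (hz : ∀ q : ℚ, Tendsto (fun n : ℕ =>
      (∑ i ∈ Finset.range n, truncLogQuantile μ v (q + z i)) / n) atTop
        (𝓝 (∫ x, truncLogQuantile μ v (q + x) ∂stdExp)))
    {t : ℕ → ℝ} {t₀ : ℝ} (ht : Tendsto t atTop (𝓝 t₀)) {k : ℕ → ℕ} (hk : Tendsto k atTop atTop) :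
    Tendsto (fun n : ℕ => (∑ i ∈ Finset.range (k n), truncLogQuantile μ v (t n + z i)) / k n) atTop
      (𝓝 (∫ x, truncLogQuantile μ v (t₀ + x) ∂stdExp)) := by
  have hcont := (continuous_integral_truncLogQuantile hγ hF hv).tendsto t₀
  have hmono : ∀ (n : ℕ) {a b : ℝ}, a ≤ b →
      (∑ i ∈ Finset.range n, truncLogQuantile μ v (a + z i)) / n ≤
        (∑ i ∈ Finset.range n, truncLogQuantile μ v (b + z i)) / n := by
    intro n a b hab
    gcongr
    exact truncLogQuantile_mono hv (by linarith)
  rw [tendsto_order]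
  constructor
  · intro w hw
    -- A rational shift just below the limit bounds the average from below by monotonicity, and
    -- continuity of the integral makes the loss small.
    obtain ⟨δ, hδ, hball⟩ := Metric.eventually_nhds_iff.1 (hcont.eventually (lt_mem_nhds hw))
    obtain ⟨q, hq1, hq2⟩ := exists_rat_btwn (sub_lt_self t₀ hδ)
    have h1 := hball (y := q) (by rw [Real.dist_eq, abs_lt]; constructor <;> linarith)
    filter_upwards [ht.eventually (lt_mem_nhds hq2),
      ((hz q).comp hk).eventually (lt_mem_nhds h1)] with n h2 h3
    exact h3.trans_le (hmono _ h2.le)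
  · intro w hw
    obtain ⟨δ, hδ, hball⟩ := Metric.eventually_nhds_iff.1 (hcont.eventually (gt_mem_nhds hw))
    obtain ⟨q, hq1, hq2⟩ := exists_rat_btwn (lt_add_of_pos_right t₀ hδ)
    have h1 := hball (y := q) (by rw [Real.dist_eq, abs_lt]; constructor <;> linarith)
    filter_upwards [ht.eventually (gt_mem_nhds hq1),
      ((hz q).comp hk).eventually (gt_mem_nhds h1)] with n h2 h3
    exact (hmono _ h2.le).trans_lt h3

lemma hillOfExcesses_eq_truncLogQuantile (hv : 0 < v) {t : ℝ} (ht : 0 < t)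
    (htv : v < expQuantile μ t) {z : ℕ → ℝ} (hz : ∀ i, 0 < z i) {k : ℕ} (hk : 0 < k) :
    hillOfExcesses μ t z k = (∑ i ∈ Finset.range k, truncLogQuantile μ v (t + z i)) / k -
      Real.log (expQuantile μ t) := by
  have hk0 : (k : ℝ) ≠ 0 := by positivity
  have h1 : ∀ i ∈ Finset.range k, (1 / (k : ℝ)) *
      Real.log (expQuantile μ (t + z i) / expQuantile μ t) =
      (1 / (k : ℝ)) * (truncLogQuantile μ v (t + z i) - Real.log (expQuantile μ t)) := by
    intro i _
    have h2 : v < expQuantile μ (t + z i) :=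
      htv.trans_le (expQuantile_mono ht (by linarith [hz i]))
    rw [truncLogQuantile, if_pos (by linarith [hz i]), max_eq_left h2.le,
      Real.log_div (hv.trans h2).ne' (hv.trans htv).ne']
  rw [hillOfExcesses, Finset.sum_congr rfl h1, ← Finset.mul_sum, Finset.sum_sub_distrib,
    Finset.sum_const, Finset.card_range, nsmul_eq_mul]
  field_simp

/-- Truncating at u / 2 is harmless: eventually the quantile at the threshold exceeds this level,
and so do all quantiles beyond it. -/
lemma tendsto_hillRemainder_const (hγ : 0 < γ) (hF : InFrechetDoA (cdf μ) γ) {u : ℝ} (hu : 0 < u)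
    {z : ℕ → ℝ} (hz0 : ∀ i, 0 < z i) (hz : ∀ q : ℚ, Tendsto (fun n : ℕ =>
      (∑ i ∈ Finset.range n, truncLogQuantile μ (u / 2) (q + z i)) / n) atTop
        (𝓝 (∫ x, truncLogQuantile μ (u / 2) (q + x) ∂stdExp))) {M : ℝ}
    (hM : Tendsto (fun n : ℕ => (∑ i ∈ Finset.range n, z i) / n) atTop (𝓝 M))
    {t : ℕ → ℝ} {t₀ : ℝ} (ht : Tendsto t atTop (𝓝 t₀)) (ht0 : ∀ᶠ n in atTop, 0 < t n)
    (htu : Tendsto (fun n => expQuantile μ (t n)) atTop (𝓝 u)) {k : ℕ → ℕ}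
    (hk : Tendsto k atTop atTop) :
    Tendsto (fun n => hillRemainder μ γ (t n) z (k n)) atTop
      (𝓝 ((∫ x, truncLogQuantile μ (u / 2) (t₀ + x) ∂stdExp) - Real.log u - γ * M)) := by
  have hv := half_pos hu
  have h := ((tendsto_average_truncLogQuantile hγ hF hv hz ht hk).sub (htu.log hu.ne')).sub
    ((hM.comp hk).const_mul γ)
  refine h.congr' ?_
  filter_upwards [ht0, htu.eventually (lt_mem_nhds (half_lt_self hu)),
    hk.eventually (eventually_gt_atTop 0)] with n h1 h2 h3
  rw [hillRemainder, hillOfExcesses_eq_truncLogQuantile hv h1 h2 hz0 h3, Function.comp_apply]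
  ring

end Remainder

/-! ### Coupling and conclusion. -/

lemma map_seqOrderStat {n k : ℕ} : expSeq.map (fun e => seqOrderStat e n k) =
    (Measure.pi fun _ : Fin n => stdExp).map fun x => orderStat x (n - k) := by
  rw [← map_expSeq_fin, Measure.map_map (measurable_orderStat _)
    (measurable_pi_lambda _ fun _ => measurable_pi_apply _)]
  rfl

lemma hasLaw_hillOfExcesses {μ : Measure ℝ} (n k : ℕ) :
    HasLaw (fun ω : (ℕ → ℝ) × (ℕ → ℝ) => hillOfExcesses μ (seqOrderStat ω.1 n k) ω.2 k)
      ((((Measure.pi fun _ : Fin n => stdExp).map fun x => orderStat x (n - k)).prod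
        (Measure.pi fun _ : Fin k => stdExp)).map fun p => ∑ a, (1 / (k : ℝ)) *
          Real.log (expQuantile μ (p.1 + p.2 a) / expQuantile μ p.1)) (expSeq.prod expSeq) := by
  have hm1 := measurable_seqOrderStat n k
  have hm2 : Measurable fun (z : ℕ → ℝ) (i : Fin k) => z i :=
    measurable_pi_lambda _ fun _ => measurable_pi_apply _
  have hφ : Measurable (Function.uncurry fun t s =>
      (1 / (k : ℝ)) * Real.log (expQuantile μ s / expQuantile μ t)) :=
    (Real.measurable_log.comp ((measurable_expQuantile.comp measurable_snd).div
      (measurable_expQuantile.comp measurable_fst))).const_mul _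
  refine ⟨((measurable_hillOfExcesses k).comp
    ((hm1.comp measurable_fst).prodMk measurable_snd)).aemeasurable, ?_⟩
  rw [← map_seqOrderStat, ← map_expSeq_fin, Measure.map_prod_map _ _ hm1 hm2,
    Measure.map_map (measurable_shiftedSum hφ) (hm1.prodMap hm2)]
  congr 1
  ext ω
  rw [hillOfExcesses, Finset.sum_range]
  rfl

theorem mainTheorem6 {Ω : Type*} [MeasurableSpace Ω] (P : Measure Ω) [IsProbabilityMeasure P]
    (μ : Measure ℝ) [IsProbabilityMeasure μ] (X : ℕ → Ω → ℝ)
    (hlaw : ∀ i, HasLaw (X i) μ P) (hindep : iIndepFun X P)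
    (γ : ℝ) (hγ : 0 < γ) (hF : InFrechetDoA (cdf μ) γ) :
    ∃ (Ω' : Type) (_ : MeasurableSpace Ω') (P' : Measure Ω') (_ : IsProbabilityMeasure P')
      (G b : ℕ → ℕ → Ω' → ℝ),
      -- `G n k` is Gamma distributed with shape `k` and scale `γ / k`, that is, rate `k / γ`
      (∀ n k : ℕ, 1 ≤ k → k < n →
        Measurable (G n k) ∧ Measurable (b n k) ∧
        HasLaw (G n k) (gammaMeasure (k : ℝ) ((k : ℝ) / γ)) P' ∧
        IdentDistrib (fun ω => hillEstimator (fun i : Fin n => X i ω) k)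
          (fun ω => G n k ω + b n k ω) P P') ∧
      (∀ k : ℕ → ℕ, (∀ᶠ n in atTop, 1 ≤ k n ∧ k n < n) →
        Tendsto (fun n : ℕ => (k n : ℝ) / (n : ℝ)) atTop (𝓝 0) →
        TendstoInMeasure P' (fun n => b n (k n)) atTop (fun _ => (0 : ℝ))) ∧
      (∀ c : ℝ, 0 < c → c ≤ 1 →
        (∃ u : ℝ, 0 < u ∧ Tendsto (tailQuantile (cdf μ)) (𝓝[Set.Ioi 1] (1 / c)) (𝓝 u)) →
        ∃ b_c : ℝ, ∀ k : ℕ → ℕ, (∀ᶠ n in atTop, 1 ≤ k n ∧ k n < n) →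
          Tendsto (fun n : ℕ => (k n : ℝ) / (n : ℝ)) atTop (𝓝 c) →
          TendstoInMeasure P' (fun n => b n (k n)) atTop (fun _ => b_c)) := by
  have hGm : ∀ k : ℕ, Measurable fun ω : (ℕ → ℝ) × (ℕ → ℝ) =>
      γ / k * ∑ i ∈ Finset.range k, ω.2 i := fun k => by fun_prop
  have hbm : ∀ n k : ℕ, Measurable fun ω : (ℕ → ℝ) × (ℕ → ℝ) =>
      hillRemainder μ γ (seqOrderStat ω.1 n k) ω.2 k := fun n k =>
    ((measurable_hillOfExcesses k).comp
      (((measurable_seqOrderStat n k).comp measurable_fst).prodMk measurable_snd)).sub (hGm k)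
  have hfst : ∀ {p : (ℕ → ℝ) → Prop}, (∀ᵐ e ∂expSeq, p e) →
      ∀ᵐ ω ∂expSeq.prod expSeq, p ω.1 := fun h => Measure.quasiMeasurePreserving_fst.ae h
  have hsnd : ∀ {p : (ℕ → ℝ) → Prop}, (∀ᵐ e ∂expSeq, p e) →
      ∀ᵐ ω ∂expSeq.prod expSeq, p ω.2 := fun h => Measure.quasiMeasurePreserving_snd.ae h
  have havg := ae_expSeq_lln measurable_id integrable_id_stdExp
  -- The first sequence produces the thresholds, the second the excesses; the product measure makes
  -- them independent.
  refine ⟨(ℕ → ℝ) × (ℕ → ℝ), inferInstance, expSeq.prod expSeq, inferInstance,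
    fun _ k ω => γ / k * ∑ i ∈ Finset.range k, ω.2 i,
    fun n k ω => hillRemainder μ γ (seqOrderStat ω.1 n k) ω.2 k, ?_, ?_, ?_⟩
  · intro n k hk hkn
    refine ⟨hGm k, hbm n k, ?_, ?_⟩
    · exact (hasLaw_scaled_sum_expSeq hγ hk).fun_comp
        (measurePreserving_snd (μ := expSeq) (ν := expSeq)).hasLaw
    · have h1 := map_hillEstimator hlaw hindep hkn
      have h2 := hasLaw_hillOfExcesses (μ := μ) n k
      simp only [hillRemainder, add_sub_cancel]
      exact ⟨h1.aemeasurable, h2.aemeasurable, h1.map_eq.trans h2.map_eq.symm⟩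
  · intro k hk hk0
    refine tendstoInMeasure_of_tendsto_ae (fun n => (hbm n (k n)).aestronglyMeasurable) ?_
    filter_upwards [hfst ae_isExpTypical, hsnd ae_expSeq_pos, hsnd havg] with ω h1 h2 h3
    exact tendsto_hillRemainder_zero hγ hF (tendsto_seqOrderStat_atTop h1 hk hk0) h2 h3 k
  · intro c hc0 hc1 ⟨u, hu, hU⟩
    refine ⟨(∫ x, truncLogQuantile μ (u / 2) (-Real.log c + x) ∂stdExp) - Real.log u -
      γ * ∫ x, x ∂stdExp, fun k hk hkc => ?_⟩
    refine tendstoInMeasure_of_tendsto_ae (fun n => (hbm n (k n)).aestronglyMeasurable) ?_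
    have hkt : Tendsto k atTop atTop := by
      rw [← tendsto_natCast_atTop_iff (R := ℝ)]
      refine (hkc.pos_mul_atTop hc0 tendsto_natCast_atTop_atTop).congr' ?_
      filter_upwards [eventually_gt_atTop 0] with n hn
      have : (n : ℝ) ≠ 0 := by positivity
      field_simp
    have hq := ae_all_iff.2 fun q : ℚ => ae_expSeq_lln
      (measurable_truncLogQuantile_add (μ := μ) (half_pos hu) q)
      (integrable_truncLogQuantile hγ hF (half_pos hu) q)
    filter_upwards [hfst ae_isExpTypical, hsnd ae_expSeq_pos, hsnd havg, hsnd hq]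
      with ω h1 h2 h3 h4
    have ht := tendsto_seqOrderStat h1 hk hkc hc0
    have ht0 : ∀ᶠ n in atTop, 0 < seqOrderStat ω.1 n (k n) := by
      filter_upwards [hk] with n hn
      exact seqOrderStat_pos h1.1 hn.2
    refine tendsto_hillRemainder_const hγ hF hu h2 h4 h3 ht ht0 ?_ hkt
    -- The quantile is `tailQuantile` at exp T, which tends to 1/c and stays above 1 because T > 0;
    -- for c = 1 this makes the one-sided limit enough.
    refine hU.comp (tendsto_nhdsWithin_iff.2 ⟨?_, ?_⟩)
    · have := (Real.continuous_exp.tendsto _).comp ht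
      rwa [Real.exp_neg, Real.exp_log hc0, ← one_div] at this
    · filter_upwards [ht0] with n hn
      exact Real.one_lt_exp_iff.2 hn
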